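/- Let $[m]=\frac{q^m-q^{-m}}{q-q^{-1}}$ for $m\in\mathbb Z$, $[n]!=[1]\cdots[n]$, and $\mathcal A=\mathbb Z[q,q^{-1}]$. Let $\mathbf U=U_q(\mathfrak{sl}_2)$ be the $\mathbb Q(q)$-algebra generated by $E,F,K^{\pm1}$ with $KK^{-1}=K^{-1}K=1$, $EF-FE=\frac{K-K^{-1}}{q-q^{-1}}$, $KE=q^2EK$, $KF=q^{-2}FK$, and put $E^{(n)}=E^n/[n]!$, $F^{(n)}=F^n/[n]!$. Let $\mathfrak t=q^{-1}EK^{-1}+F$ and let $\mathbf U^\imath\subset\mathbf U$ be the subalgebra generated by $\mathfrak t$. The $\imath$-divided powers (of even weight) are $\mathfrak t^{(0)}_{\rm ev}=1$ and $$\mathfrak t^{(2a)}_{\rm ev}=\frac{\mathfrak t\,(\mathfrak t-[-2a+2])(\mathfrak t-[-2a+4])\cdots(\mathfrak t-[2a-2])}{[2a]!}\ (a\ge1),\qquad \mathfrak t^{(2a+1)}_{\rm ev}=\frac{(\mathfrak t-[-2a])(\mathfrak t-[-2a+2])\cdots(\mathfrak t-[2a])}{[2a+1]!}\ (a\ge0).$$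 For $\mu\in\mathbb N$ let $L(\mu)=\mathbf U/(\mathbf UE+\mathbf U(K-q^\mu)+\mathbf UF^{\mu+1})$, the simple $\mathbf U$-module of highest weight $\mu$, with highest weight vector $v^+_\mu$ (the class of $1$) and canonical basis $\{F^{(a)}v^+_\mu\mid 0\le a\le\mu\}$. A bar involution $\psi_\imath$ of $L(\mu)$ is an additive map, antilinear with respect to $q\mapsto q^{-1}$, which fixes $v^+_\mu$ and commutes with $\mathfrak t$. An element $b^\mu_a$ ($0\le a\le\mu$) is an $a$-th $\imath$-canonical basis element of $L(\mu)$ if it is fixed by a bar involution and $$b^\mu_a\in F^{(a)}v^+_\mu+\sum_{0\le r\le\mu}q^{-1}\mathbb Z[q^{-1}]\,F^{(r)}v^+_\mu .$$ A family $(b^\mu_a)_{0\le a\le\mu}$ of such elements which is a $\mathbb Q(q)$-basis of $L(\mu)$ is called the $\imath$-canonical basis of $L(\mu)$. The bar involution of $\mathbf U^\imath$ is the ring endomorphism with $q\mapsto q^{-1}$, $\mathfrak t\mapsto\mathfrak t$. For $k\in\mathbb Z$ let $\dot{\mathbf U}\mathbf 1_{k}=\mathbf U/\mathbf U(K-q^{k})$,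 with $\mathbf 1_k$ the class of $1$, and let ${}_{\mathcal A}\dot{\mathbf U}\mathbf 1_k$ be the $\mathcal A$-span of all products of divided powers $E^{(n)},F^{(n)}$ applied to $\mathbf 1_k$. Let ${}_{\mathcal A}\mathbf U^\imath$ be the set of $x\in\mathbf U^\imath$ with $x\cdot{}_{\mathcal A}\dot{\mathbf U}\mathbf 1_{2k}\subset{}_{\mathcal A}\dot{\mathbf U}\mathbf 1_{2k}$ for all $k\in\mathbb Z$. A family $(b_n)_{n\in\mathbb N}$ in $\mathbf U^\imath$ is the $\imath$-canonical basis of $\mathbf U^\imath$ (for even weights) if it is a $\mathbb Q(q)$-basis of $\mathbf U^\imath$ whose $\mathcal A$-span is ${}_{\mathcal A}\mathbf U^\imath$, every $b_n$ is bar invariant, and for each $n$ the vector $b_nv^+_{2\lambda}$ is an $n$-th $\imath$-canonical basis element of $L(2\lambda)$ for all sufficiently large $\lambda$. **Theorem.** 1. For each $\lambda\in\mathbb N$ the following hold. - $L(2\lambda)$ is a simple $\mathbf U$-module, $v^+_{2\lambda}\ne0$, $Ev^+_{2\lambda}=0$, $Kv^+_{2\lambda}=q^{2\lambda}v^+_{2\lambda}$,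 and $\{F^{(a)}v^+_{2\lambda}\mid0\le a\le2\lambda\}$ is a $\mathbb Q(q)$-basis of it. - $L(2\lambda)$ has exactly one bar involution $\psi_\imath$, and an antilinear map $\psi$ on $L(2\lambda)$ equals $\psi_\imath$ if and only if it fixes $\mathfrak t^{(n)}_{\rm ev}v^+_{2\lambda}$ for all $n\ge0$. - $\{\mathfrak t^{(n)}_{\rm ev}v^+_{2\lambda}\mid 0\le n\le2\lambda\}$ is the $\imath$-canonical basis of $L(2\lambda)$, and $\mathfrak t^{(n)}_{\rm ev}v^+_{2\lambda}$ is the only $n$-th $\imath$-canonical basis element for $0\le n\le2\lambda$. - $\mathfrak t^{(n)}_{\rm ev}v^+_{2\lambda}=0$ for $n>2\lambda$. - For $0\le n\le2\lambda$, $\mathfrak t^{(n)}_{\rm ev}v^+_{2\lambda}\in F^{(n)}v^+_{2\lambda}+\sum_{0\le r<n}q^{-1}\mathbb N[q^{-1}]F^{(r)}v^+_{2\lambda}$; that is, the transition matrix to the canonical basis is unitriangular with off-diagonal entries in $q^{-1}\mathbb N[q^{-1}]$. - There is a $\mathbf U^\imath$-homomorphism $L(2\lambda+2)\to L(2\lambda)$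 with $v^+_{2\lambda+2}\mapsto v^+_{2\lambda}$. 2. The bar involution of $\mathbf U^\imath$ exists and is unique, and $\{\mathfrak t^{(n)}_{\rm ev}\mid n\in\mathbb N\}$ is the $\imath$-canonical basis of $\mathbf U^\imath$; it is the only family with the defining properties. -/

import Mathlib

open Polynomial

namespace ISl2

noncomputable section

/-! The ground field `ℚ(q)`, its subring `ℤ[q, q⁻¹]`, and quantum integers. -/

/-- The field `ℚ(q)`. -/
abbrev Kq : Type := RatFunc ℚ

/-- The variable `q`. -/
def q : Kq := RatFunc.X

/-- The ring `𝒜 = ℤ[q, q⁻¹]`, inside `ℚ(q)`. -/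
def Aq : Subalgebra ℤ Kq := Algebra.adjoin ℤ {q, q⁻¹}

/-- `q⁻¹ ℤ[q⁻¹]`, inside `ℚ(q)`. -/
def qInvZ : Set Kq := {x | ∃ p : ℤ[X], x = q⁻¹ * aeval q⁻¹ p}

/-- `q⁻¹ ℕ[q⁻¹]`, inside `ℚ(q)`. -/
def qInvN : Set Kq := {x | ∃ p : ℕ[X], x = q⁻¹ * aeval q⁻¹ p}

/-- The quantum integer `[m]`, for `m ∈ ℤ`. -/
def qInt (m : ℤ) : Kq := (q ^ m - q ^ (-m)) / (q - q⁻¹)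

/-- The quantum factorial `[n]! = [1] [2] ⋯ [n]`. -/
def qFact (n : ℕ) : Kq := ∏ i ∈ Finset.range n, qInt ((i : ℤ) + 1)

theorem transcendental_q : Transcendental ℚ q := by
  have h := RatFunc.transcendental_X (K := ℚ)
  unfold q
  convert h
  exact Subsingleton.elim _ _

theorem aeval_q_inv_injective :
    Function.Injective ((aeval (R := ℚ) q⁻¹ : ℚ[X] →ₐ[ℚ] Kq) : ℚ[X] →+* Kq) := by
  have h : Transcendental ℚ q⁻¹ := fun h => transcendental_q (by simpa using h.inv)
  exact transcendental_iff_injective.mp h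

/-- The bar involution of the field `ℚ(q)`: the `ℚ`-algebra endomorphism with `q ↦ q⁻¹`. -/
def bar : Kq →+* Kq := IsFractionRing.lift aeval_q_inv_injective

theorem bar_q : bar q = q⁻¹ := by
  have h : q = algebraMap ℚ[X] Kq X := RatFunc.algebraMap_X.symm
  have h2 : bar (algebraMap ℚ[X] Kq X) = q⁻¹ := by
    unfold bar
    rw [IsFractionRing.lift_algebraMap]
    simp
  rw [← h] at h2
  exact h2

/-! The quantum group `U = U_q(sl₂)`. -/

/-- The generators `E, F, K, K⁻¹`. -/
inductive Gen : Type
  | E | F | K | Ki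

/-- The free algebra on the generators. -/
abbrev FreeU : Type := FreeAlgebra Kq Gen

/-- A generator as an element of the free algebra. -/
abbrev gen (x : Gen) : FreeU := FreeAlgebra.ι Kq x

/-- The defining relations of `U_q(sl₂)`. -/
inductive URel : FreeU → FreeU → Prop
  | K_Ki : URel (gen .K * gen .Ki) 1
  | Ki_K : URel (gen .Ki * gen .K) 1
  | E_F : URel (gen .E * gen .F - gen .F * gen .E) ((q - q⁻¹)⁻¹ • (gen .K - gen .Ki))
  | K_E : URel (gen .K * gen .E) (q ^ 2 • (gen .E * gen .K))
  | K_F : URel (gen .K * gen .F) ((q ^ 2)⁻¹ • (gen .F * gen .K))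

/-- The quantum group `U = U_q(sl₂)` over `ℚ(q)`. -/
abbrev U : Type := RingQuot URel

/-- The images of the generators in `U`. -/
def ofGen (x : Gen) : U := RingQuot.mkAlgHom Kq URel (gen x)

/-- The generator `E`. -/
def E : U := ofGen .E
/-- The generator `F`. -/
def F : U := ofGen .F
/-- The generator `K`. -/
def K : U := ofGen .K
/-- The generator `K⁻¹`. -/
def Ki : U := ofGen .Ki

/-- The divided power `E⁽ⁿ⁾ = Eⁿ / [n]!`. -/
def Ediv (n : ℕ) : U := (qFact n)⁻¹ • E ^ n

/-- The divided power `F⁽ⁿ⁾ = Fⁿ / [n]!`. -/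
def Fdiv (n : ℕ) : U := (qFact n)⁻¹ • F ^ n

/-! The coideal subalgebra `Uⁱ` and the `ı`-divided powers. -/

/-- `𝔱 = q⁻¹ E K⁻¹ + F`. -/
def t : U := q⁻¹ • (E * Ki) + F

/-- The coideal subalgebra `Uⁱ`, generated by `𝔱`. -/
def Ui : Subalgebra Kq U := Algebra.adjoin Kq {t}

/-- `𝔱` as an element of `Uⁱ`. -/
def tI : Ui := ⟨t, Algebra.subset_adjoin rfl⟩

/-- The polynomial whose value at `𝔱` is the `n`-th `ı`-divided power of even weight:
`1` for `n = 0`; `x (x - [-2a+2]) (x - [-2a+4]) ⋯ (x - [2a-2]) / [2a]!` for `n = 2a ≥ 2`;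
`(x - [-2a]) (x - [-2a+2]) ⋯ (x - [2a]) / [2a+1]!` for `n = 2a+1`. -/
def evPoly (n : ℕ) : Kq[X] :=
  if n = 0 then 1
  else if Even n then
    C (qFact n)⁻¹ * (X * ∏ i ∈ Finset.range (n - 1), (X - C (qInt (2 * (i : ℤ) - (n : ℤ) + 2))))
  else
    C (qFact n)⁻¹ * ∏ i ∈ Finset.range n, (X - C (qInt (2 * (i : ℤ) - (n : ℤ) + 1)))

/-- The `ı`-divided power `𝔱⁽ⁿ⁾_ev` in `Uⁱ`. -/
def dvev (n : ℕ) : Ui := aeval tI (evPoly n)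

/-! The finite-dimensional simple modules `L(μ)`. -/

/-- The left ideal `U E + U (K - q^μ) + U F^(μ+1)`. -/
def LIdeal (μ : ℕ) : Submodule U U :=
  Submodule.span U {E, K - algebraMap Kq U (q ^ μ), F ^ (μ + 1)}

/-- The simple `U`-module `L(μ)` of highest weight `μ`, as the quotient of `U` (equivalently, of
the Verma module of highest weight `μ`) by its usual defining left ideal. -/
abbrev L (μ : ℕ) : Type := U ⧸ LIdeal μ

/-- The highest weight vector `v⁺` of `L(μ)`. -/
def vPlus (μ : ℕ) : L μ := Submodule.Quotient.mk 1

/-- The canonical basis `F⁽ᵃ⁾ v⁺`, `0 ≤ a ≤ μ`, of `L(μ)`. -/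
def canL (μ : ℕ) (a : Fin (μ + 1)) : L μ := Fdiv a • vPlus μ

/-- `ψ` is the bar involution `ψ_ı` of `L(μ)`: a map, antilinear with respect to `q ↦ q⁻¹`, which
fixes `v⁺` and commutes with the generator `𝔱` of `Uⁱ`. -/
structure IsIBar (μ : ℕ) (ψ : L μ →ₛₗ[bar] L μ) : Prop where
  fix_v : ψ (vPlus μ) = vPlus μ
  comm_t : ∀ x : L μ, ψ (t • x) = t • ψ x

/-- `x` is the `a`-th `ı`-canonical basis element `b^μ_a` of `L(μ)`: it is `ψ_ı`-invariant and lies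
in `F⁽ᵃ⁾ v⁺ + ∑_{0 ≤ r ≤ μ} q⁻¹ ℤ[q⁻¹] F⁽ʳ⁾ v⁺`. -/
structure IsICanonicalElement (μ : ℕ) (a : Fin (μ + 1)) (x : L μ) : Prop where
  invariant : ∃ ψ : L μ →ₛₗ[bar] L μ, IsIBar μ ψ ∧ ψ x = x
  lattice : ∃ c : Fin (μ + 1) → Kq, (∀ r, c r ∈ qInvZ) ∧
    x = canL μ a + ∑ r, c r • canL μ r

/-- The family `b` is the `ı`-canonical basis of `L(μ)`. -/
structure IsICanonicalBasisL (μ : ℕ) (b : Fin (μ + 1) → L μ) : Prop where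
  linearIndependent : LinearIndependent Kq b
  span_eq_top : Submodule.span Kq (Set.range b) = ⊤
  element : ∀ a, IsICanonicalElement μ a (b a)

/-! The integral form of `Uⁱ` of even weights. -/

/-- The left `U`-module `U̇ 1_k = U / U (K - q^k)`, the `k`-th column of the modified quantum
group. The class of `1` is the idempotent `1_k`. -/
abbrev dotU (k : ℤ) : Type :=
  U ⧸ (Submodule.span U {K - algebraMap Kq U (q ^ k)} : Submodule U U)

/-- The idempotent `1_k`. -/
def dotOne (k : ℤ) : dotU k := Submodule.Quotient.mk 1

/-- The `𝒜`-subalgebra of `U` generated by all the divided powers of `E` and `F`. -/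
def UA : Subalgebra Aq U := Algebra.adjoin Aq (Set.range Ediv ∪ Set.range Fdiv)

/-- The `𝒜`-form of `U̇ 1_k`: the `𝒜`-span of the products of divided powers of `E` and `F`,
applied to `1_k`. -/
def dotUA (k : ℤ) : Submodule Aq (dotU k) :=
  Submodule.span Aq {x | ∃ u ∈ UA, x = u • dotOne k}

/-- The `𝒜`-form of `Uⁱ` of even weights: those elements of `Uⁱ` that map the `𝒜`-form of
`U̇_ev = ⨁ U̇ 1_{2k}` to itself. -/
def UiA : Submodule Aq Ui where
  carrier := {x | ∀ k : ℤ, ∀ y ∈ dotUA (2 * k), x • y ∈ dotUA (2 * k)}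
  zero_mem' := fun k y _ => by
    rw [zero_smul]
    exact Submodule.zero_mem _
  add_mem' := fun hx hy k z hz => by
    rw [add_smul]
    exact Submodule.add_mem _ (hx k z hz) (hy k z hz)
  smul_mem' := fun c x hx k y hy => by
    have h : (c • x) • y = c • (x • y) := smul_assoc (c : Kq) x y
    rw [h]
    exact Submodule.smul_mem _ c (hx k y hy)

/-! The `ı`-canonical basis of `Uⁱ` (for even weights). -/

/-- `φ` is the bar involution `ψ_ı` of the algebra `Uⁱ`: the ring endomorphism with `q ↦ q⁻¹` on
scalars and `𝔱 ↦ 𝔱`. -/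
structure IsIBarAlg (φ : Ui →+* Ui) : Prop where
  antilinear : ∀ (c : Kq) (x : Ui), φ (c • x) = bar c • φ x
  fix_t : φ tI = tI

/-- The family `b` is the `ı`-canonical basis of `Uⁱ` for the system `{L(2l)}`: it is a basis of
`Uⁱ` over `ℚ(q)` and of the integral form of `Uⁱ` over `𝒜`, it is bar invariant, and `b n` maps
the highest weight vector of `L(2l)` to the `n`-th `ı`-canonical basis element for all
sufficiently large `l`. -/
structure IsICanonicalBasisUi (b : ℕ → Ui) : Prop where
  linearIndependent : LinearIndependent Kq b
  span_eq_top : Submodule.span Kq (Set.range b) = ⊤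
  integral_span : Submodule.span Aq (Set.range b) = UiA
  invariant : ∃ φ : Ui →+* Ui, IsIBarAlg φ ∧ ∀ n, φ (b n) = b n
  stable : ∀ n : ℕ, ∃ l₀ : ℕ, ∀ l ≥ l₀, ∃ h : n < 2 * l + 1,
    IsICanonicalElement (2 * l) ⟨n, h⟩ (b n • vPlus (2 * l))

end

end ISl2

/-!
The `ı`-divided powers satisfy a recursion with quantum integers as coefficients: `𝔱 𝔱⁽²ᵐ⁾ =
[2m+1] 𝔱⁽²ᵐ⁺¹⁾ + [2m] 𝔱⁽²ᵐ⁻¹⁾` and `𝔱 𝔱⁽²ᵐ⁺¹⁾ = [2m+2] 𝔱⁽²ᵐ⁺²⁾` (`tI_mul_dvev_even`,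
`tI_mul_dvev_odd`). Solving it gives the PBW expansion of the `ı`-divided powers on vectors `w` of
weight `2l` in an arbitrary `U`-module (`IsWt.dvev_smul`): with `s = b + c`,

* `𝔱⁽²ᵐ⁾ w = ∑ q^(-2s(l-m+s)+c) [l-m+s; c] F⁽²ᵐ⁻²ᶜ⁻ᵇ⁾ E⁽ᵇ⁾ w`,
* `𝔱⁽²ᵐ⁺¹⁾ w = ∑ q^(-2s(l-m+s)+s) [l-m-1+s; c] F⁽²ᵐ⁺¹⁻²ᶜ⁻ᵇ⁾ E⁽ᵇ⁾ w`,

the sums being over `b, c ≥ 0` and the Gaussian binomials being taken in `q²`. That these closed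
forms satisfy the recursion is a family of identities between Laurent monomials and quantum
integers (`oddCoef_step_succ`, `evenCoef_step_succ`). Everything else is read off from the
expansion.

On the highest weight vector of `L(2l)` only the terms with `b = 0` survive. The coefficients with
`c > 0` lie in `q⁻¹ ℕ[q⁻¹]`, by the `q`-Pascal rule, and for `m = l` the odd ones vanish. So the
vectors `𝔱⁽ⁿ⁾ v⁺`, `n ≤ 2l`, are obtained from the canonical basis by a unitriangular matrix over
`ℕ[q⁻¹]` (`IsHighestWeight.exists_transition`), and `𝔱⁽ⁿ⁾ v⁺ = 0` for `n > 2l`. As the recursion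
is bar invariant, the antilinear map that fixes this basis commutes with `𝔱`; it is the bar
involution. The same argument gives the projections `L(2l+2) → L(2l)`. Uniqueness of `ı`-canonical
basis elements holds because a bar-invariant element of `q⁻¹ ℤ[q⁻¹]` is zero
(`IsHighestWeight.eq_zero_of_bar`).

For `Uⁱ`, the coefficients of an element in the `ı`-divided powers are its coordinates on `v⁺ ∈
L(2l)` for large `l` (`IsHighestWeight.dvBasis_repr_sum_smul`), so `Uⁱ` is a polynomial ring in
`𝔱`. The `ı`-divided powers preserve the integral form since the PBW coefficients lie in `𝒜`
(`dvev_mem_UiA`). Conversely, an element of the integral form maps `v⁺` into the lattice of the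
canonical basis of `L(2l)`, and a unitriangular matrix over `𝒜` does not introduce denominators
(`coeff_mem_Aq`).
-/

open Polynomial

namespace ISl2

noncomputable section

/-! ### Quantum integers and Gaussian binomials over a field -/

section Generic

variable {k : Type*} [Field k]

/-- The quantum integer `[m]` in the variable `v`. -/
def vInt (v : k) (m : ℤ) : k := (v ^ m - v ^ (-m)) / (v - v⁻¹)

/-- The Gaussian binomial `[x; c] = ∏_{i < c} [x - i] / [i + 1]` in the variable `v`, with
arbitrary integer top `x`. -/
def vBinom (v : k) (x : ℤ) (c : ℕ) : k :=
  ∏ i ∈ Finset.range c, vInt v (x - i) / vInt v ((i : ℤ) + 1)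

theorem vInt_zero (v : k) : vInt v 0 = 0 := by simp [vInt]

theorem vInt_one {v : k} (h : v - v⁻¹ ≠ 0) : vInt v 1 = 1 := by
  simp [vInt, div_self h]

theorem vInt_neg (v : k) (m : ℤ) : vInt v (-m) = -vInt v m := by
  simp only [vInt, neg_neg]
  ring

theorem vBinom_zero_right (v : k) (x : ℤ) : vBinom v x 0 = 1 := by simp [vBinom]

theorem vBinom_zero_succ (v : k) (c : ℕ) : vBinom v 0 (c + 1) = 0 := by
  rw [vBinom, Finset.prod_range_succ']
  simp [vInt_zero]

theorem vBinom_succ_mul {v : k} (x : ℤ) {c : ℕ} (hc : vInt v ((c : ℤ) + 1) ≠ 0) :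
    vBinom v x (c + 1) * vInt v ((c : ℤ) + 1) = vInt v (x - c) * vBinom v x c := by
  rw [vBinom, Finset.prod_range_succ, ← vBinom]
  field_simp

theorem vBinom_succ_mul' {v : k} (x : ℤ) {c : ℕ} (hc : vInt v ((c : ℤ) + 1) ≠ 0) :
    vBinom v x (c + 1) * vInt v ((c : ℤ) + 1) = vInt v x * vBinom v (x - 1) c := by
  simp only [vBinom, Finset.prod_div_distrib]
  rw [Finset.prod_range_succ', Finset.prod_range_succ _ c]
  have : ∀ i : ℕ, x - ((i + 1 : ℕ) : ℤ) = x - 1 - i := fun i => by push_cast; ring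
  simp only [this]
  push_cast
  field_simp
  simp

theorem vInt_add {v : k} (hv : v ≠ 0) (x y : ℤ) :
    vInt v (x + y) = v ^ x * vInt v y + v ^ (-y) * vInt v x := by
  simp only [vInt, neg_add, zpow_add₀ hv]
  ring

theorem vBinom_pascal {v : k} (hv : v ≠ 0) (x : ℤ) {c : ℕ} (hc : vInt v ((c : ℤ) + 1) ≠ 0) :
    vBinom v (x + 1) (c + 1) =
      v ^ ((c : ℤ) + 1) * vBinom v x (c + 1) + v ^ (-(x - c)) * vBinom v x c := by
  apply mul_right_cancel₀ hc
  rw [add_mul, mul_assoc, vBinom_succ_mul x hc, vBinom_succ_mul' (x + 1) hc,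
    show x + 1 = ((c : ℤ) + 1) + (x - c) by ring, vInt_add hv,
    show ((c : ℤ) + 1) + (x - c) - 1 = x by ring]
  ring

/-- Gaussian binomials lie in every subring containing `v` and `v⁻¹`. -/
theorem vBinom_mem {S : Type*} [SetLike S k] [SubringClass S k] (A : S) {v : k} (hv : v ≠ 0)
    (h1 : v ∈ A) (h2 : v⁻¹ ∈ A) (hn : ∀ c : ℕ, vInt v ((c : ℤ) + 1) ≠ 0) (c : ℕ) (x : ℤ) :
    vBinom v x c ∈ A := by
  have hz : ∀ n : ℤ, v ^ n ∈ A := by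
    intro n
    obtain ⟨n, rfl | rfl⟩ := n.eq_nat_or_neg
    · simpa using pow_mem h1 n
    · simpa using pow_mem h2 n
  induction c generalizing x with
  | zero => rw [vBinom_zero_right]; exact one_mem A
  | succ c ih =>
    induction x using Int.induction_on with
    | zero => rw [vBinom_zero_succ]; exact zero_mem A
    | succ i hi =>
      rw [vBinom_pascal hv _ (hn c)]
      exact add_mem (mul_mem (hz _) hi) (mul_mem (hz _) (ih _))
    | pred i hi =>
      have h := vBinom_pascal hv (-(i : ℤ) - 1) (hn c)
      rw [sub_add_cancel] at h
      have h' : vBinom v (-(i : ℤ) - 1) (c + 1) = v ^ (-((c : ℤ) + 1)) *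
          (vBinom v (-(i : ℤ)) (c + 1) -
            v ^ (-(-(i : ℤ) - 1 - c)) * vBinom v (-(i : ℤ) - 1) c) := by
        rw [h, add_sub_cancel_right, ← mul_assoc, ← zpow_add₀ hv]
        simp
      rw [h']
      exact mul_mem (hz _) (sub_mem hi (mul_mem (hz _) (ih _)))

/-- The coefficient of `F⁽²ᵐ⁻²ᶜ⁻ᵇ⁾ E⁽ᵇ⁾` in the `ı`-divided power of index `2m` on weight `2l`,
as a function of `d = l - m`. -/
def evenCoef (v : k) (d b : ℤ) (c : ℕ) : k :=
  v ^ (-2 * (b + c) * (d + (b + c)) + c) * vBinom (v ^ 2) (d + (b + c)) c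

/-- The coefficient of `F⁽²ᵐ⁺¹⁻²ᶜ⁻ᵇ⁾ E⁽ᵇ⁾` in the `ı`-divided power of index `2m + 1` on weight
`2l`, as a function of `d = l - m`. -/
def oddCoef (v : k) (d b : ℤ) (c : ℕ) : k :=
  v ^ (-2 * (b + c) * (d + (b + c)) + (b + c)) * vBinom (v ^ 2) (d - 1 + (b + c)) c

theorem vInt_sq (v : k) (m : ℤ) : vInt (v ^ 2) m = (v ^ m * v ^ m - (v ^ m * v ^ m)⁻¹) *
    (v ^ 2 - (v ^ 2)⁻¹)⁻¹ := by
  rw [vInt, zpow_neg, ← zpow_natCast, ← zpow_mul, mul_comm, zpow_mul, div_eq_mul_inv]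
  norm_num [zpow_two, pow_two]

/-- The coefficients without binomial factor, in the step from index `2m + 1` to `2m + 2`. -/
theorem oddCoef_step_zero {v : k} (hv : v ≠ 0) (l m b : ℤ) :
    vInt v (2 * m + 2) * evenCoef v (l - m - 1) b 0 =
      vInt v (2 * m + 2 - b) * oddCoef v (l - m) b 0 +
      v ^ (1 - 2 * l - 2 * b + 2 * (2 * m + 2 - b)) * (vInt v b * oddCoef v (l - m) (b - 1) 0) := by
  simp only [evenCoef, oddCoef, vBinom_zero_right, vInt]
  -- `v ^ e` carries the part of the exponents that is quadratic in the parameters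
  obtain ⟨e, he⟩ : ∃ e : ℤ, e = -2 * b * (l - m + b) := ⟨_, rfl⟩
  have e1 : -2 * (b + (0 : ℕ)) * (l - m - 1 + (b + (0 : ℕ))) + (0 : ℕ) = e + b + b := by
    rw [he]; push_cast; ring
  have e2 : -2 * (b + (0 : ℕ)) * (l - m + (b + (0 : ℕ))) + (b + (0 : ℕ)) = e + b := by
    rw [he]; push_cast; ring
  have e3 : -2 * (b - 1 + (0 : ℕ)) * (l - m + (b - 1 + (0 : ℕ))) + (b - 1 + (0 : ℕ)) =
      e + (l + l) - (m + m) + (b + b + b + b) + b - 1 - 1 - 1 := by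
    rw [he]; push_cast; ring
  rw [e1, e2, e3]
  simp only [two_mul, zpow_add₀ hv, zpow_sub₀ hv, zpow_neg, zpow_one, div_eq_mul_inv _ (v - v⁻¹)]
  have h1 := zpow_ne_zero e hv
  have h2 := zpow_ne_zero b hv
  have h3 := zpow_ne_zero m hv
  have h4 := zpow_ne_zero l hv
  norm_num only [zpow_ofNat]
  generalize v ^ e = e' at *
  generalize v ^ b = b' at *
  generalize v ^ m = m' at *
  generalize v ^ l = l' at *
  generalize (v - v⁻¹)⁻¹ = D
  field_simp
  ring

/-- The recursion for the coefficients in the step from index `2m + 1` to `2m + 2`. -/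
theorem oddCoef_step_succ {v : k} (hv : v ≠ 0)
    (hn : ∀ c : ℕ, vInt (v ^ 2) ((c : ℤ) + 1) ≠ 0) (l m b : ℤ) (c : ℕ) :
    vInt v (2 * m + 2) * evenCoef v (l - m - 1) b (c + 1) =
      vInt v (2 * m - 2 * c - b) * oddCoef v (l - m) b (c + 1) +
      v ^ (1 - 2 * l - 2 * b + 2 * (2 * m - 2 * c - b)) *
        (vInt v b * oddCoef v (l - m) (b - 1) (c + 1) +
          vInt v (2 * l + 2 * b - (2 * m - 2 * c - b)) * oddCoef v (l - m) b c) := by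
  obtain ⟨x, hx⟩ : ∃ x : ℤ, x = l - m - 1 + b + c := ⟨_, rfl⟩
  -- all binomials are products of `R` and one quantum integer
  obtain ⟨R, hR⟩ : ∃ R, R = vBinom (v ^ 2) x c / vInt (v ^ 2) ((c : ℤ) + 1) := ⟨_, rfl⟩
  have r1 : vBinom (v ^ 2) (x + 1) (c + 1) = vInt (v ^ 2) (x + 1) * R := by
    have := vBinom_succ_mul' (v := v ^ 2) (x + 1) (hn c)
    rw [add_sub_cancel_right] at this
    rw [hR, ← mul_div_assoc, eq_div_iff (hn c), this]
  have r2 : vBinom (v ^ 2) x (c + 1) = vInt (v ^ 2) (x - c) * R := by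
    rw [hR, ← mul_div_assoc, eq_div_iff (hn c), vBinom_succ_mul x (hn c)]
  have r3 : vBinom (v ^ 2) x c = vInt (v ^ 2) ((c : ℤ) + 1) * R := by
    rw [hR, mul_div_cancel₀ _ (hn c)]
  simp only [evenCoef, oddCoef]
  rw [show l - m - 1 + (b + ((c + 1 : ℕ) : ℤ)) = x + 1 by rw [hx]; push_cast; ring,
    show l - m - 1 + (b - 1 + ((c + 1 : ℕ) : ℤ)) = x by rw [hx]; push_cast; ring,
    show l - m - 1 + (b + (c : ℤ)) = x by rw [hx]; ring, r1, r2, r3,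
    show x - c = l - m - 1 + b by rw [hx]; ring, hx]
  simp only [vInt_sq]
  simp only [vInt]
  -- `v ^ e` carries the part of the exponents that is quadratic in the parameters
  obtain ⟨e, he⟩ : ∃ e : ℤ, e = -2 * (b + c) * (l - m + b + c) := ⟨_, rfl⟩
  rw [show -2 * (b + ((c + 1 : ℕ) : ℤ)) * (l - m - 1 + b + c + 1) + ((c + 1 : ℕ) : ℤ) =
      e + (m + m) - (l + l) - (b + b) - c + 1 by rw [he]; push_cast; ring,
    show -2 * (b + ((c + 1 : ℕ) : ℤ)) * (l - m + (b + ((c + 1 : ℕ) : ℤ))) +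
      (b + ((c + 1 : ℕ) : ℤ)) = e - (l + l) + (m + m) - (b + b + b) - (c + c + c) - 1 by
        rw [he]; push_cast; ring,
    show -2 * (b - 1 + ((c + 1 : ℕ) : ℤ)) * (l - m + (b - 1 + ((c + 1 : ℕ) : ℤ))) +
      (b - 1 + ((c + 1 : ℕ) : ℤ)) = e + b + c by rw [he]; push_cast; ring,
    show -2 * (b + (c : ℤ)) * (l - m + (b + (c : ℤ))) + (b + (c : ℤ)) = e + b + c by
      rw [he]; ring]
  simp only [two_mul, zpow_add₀ hv, zpow_sub₀ hv, zpow_neg, zpow_one, div_eq_mul_inv _ (v - v⁻¹)]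
  have h1 := zpow_ne_zero e hv
  have h2 := zpow_ne_zero b hv
  have h3 := zpow_ne_zero m hv
  have h4 := zpow_ne_zero l hv
  have h5 := zpow_ne_zero (c : ℤ) hv
  norm_num only [zpow_ofNat]
  generalize v ^ e = e' at *
  generalize v ^ b = b' at *
  generalize v ^ m = m' at *
  generalize v ^ l = l' at *
  generalize v ^ (c : ℤ) = c' at *
  generalize (v - v⁻¹)⁻¹ = D
  generalize (v ^ 2 - (v ^ 2)⁻¹)⁻¹ = D'
  field_simp
  ring

/-- The coefficients without binomial factor, in the step from index `2m` to `2m + 1`. -/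
theorem evenCoef_step_zero {v : k} (hv : v ≠ 0) (l m b : ℤ) :
    vInt v (2 * m + 1) * oddCoef v (l - m) b 0 =
      vInt v (2 * m + 1 - b) * evenCoef v (l - m) b 0 +
      v ^ (1 - 2 * l - 2 * b + 2 * (2 * m + 1 - b)) *
        (vInt v b * evenCoef v (l - m) (b - 1) 0) := by
  simp only [evenCoef, oddCoef, vBinom_zero_right, vInt]
  -- `v ^ e` carries the part of the exponents that is quadratic in the parameters
  obtain ⟨e, he⟩ : ∃ e : ℤ, e = -2 * b * (l - m + b) := ⟨_, rfl⟩
  have e1 : -2 * (b + (0 : ℕ)) * (l - m + (b + (0 : ℕ))) + (0 : ℕ) = e := by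
    rw [he]; push_cast; ring
  have e2 : -2 * (b + (0 : ℕ)) * (l - m + (b + (0 : ℕ))) + (b + (0 : ℕ)) = e + b := by
    rw [he]; push_cast; ring
  have e3 : -2 * (b - 1 + (0 : ℕ)) * (l - m + (b - 1 + (0 : ℕ))) + (0 : ℕ) =
      e + (l + l) - (m + m) + (b + b + b + b) - 1 - 1 := by
    rw [he]; push_cast; ring
  rw [e1, e2, e3]
  simp only [two_mul, zpow_add₀ hv, zpow_sub₀ hv, zpow_neg, zpow_one, div_eq_mul_inv _ (v - v⁻¹)]
  have h1 := zpow_ne_zero e hv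
  have h2 := zpow_ne_zero b hv
  have h3 := zpow_ne_zero m hv
  have h4 := zpow_ne_zero l hv
  generalize v ^ e = e' at *
  generalize v ^ b = b' at *
  generalize v ^ m = m' at *
  generalize v ^ l = l' at *
  generalize (v - v⁻¹)⁻¹ = D
  field_simp
  ring

/-- The recursion for the coefficients in the step from index `2m` to `2m + 1`. -/
theorem evenCoef_step_succ {v : k} (hv : v ≠ 0)
    (hn : ∀ c : ℕ, vInt (v ^ 2) ((c : ℤ) + 1) ≠ 0) (l m b : ℤ) (c : ℕ) :
    vInt v (2 * m + 1) * oddCoef v (l - m) b (c + 1) +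
        vInt v (2 * m) * oddCoef v (l - m + 1) b c =
      vInt v (2 * m - 1 - 2 * c - b) * evenCoef v (l - m) b (c + 1) +
      v ^ (1 - 2 * l - 2 * b + 2 * (2 * m - 1 - 2 * c - b)) *
        (vInt v b * evenCoef v (l - m) (b - 1) (c + 1) +
          vInt v (2 * l + 2 * b - (2 * m - 1 - 2 * c - b)) * evenCoef v (l - m) b c) := by
  obtain ⟨x, hx⟩ : ∃ x : ℤ, x = l - m + b + c := ⟨_, rfl⟩
  -- all binomials are products of `R` and one quantum integer
  obtain ⟨R, hR⟩ : ∃ R, R = vBinom (v ^ 2) x c / vInt (v ^ 2) ((c : ℤ) + 1) := ⟨_, rfl⟩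
  have r1 : vBinom (v ^ 2) (x + 1) (c + 1) = vInt (v ^ 2) (x + 1) * R := by
    have := vBinom_succ_mul' (v := v ^ 2) (x + 1) (hn c)
    rw [add_sub_cancel_right] at this
    rw [hR, ← mul_div_assoc, eq_div_iff (hn c), this]
  have r2 : vBinom (v ^ 2) x (c + 1) = vInt (v ^ 2) (x - c) * R := by
    rw [hR, ← mul_div_assoc, eq_div_iff (hn c), vBinom_succ_mul x (hn c)]
  have r3 : vBinom (v ^ 2) x c = vInt (v ^ 2) ((c : ℤ) + 1) * R := by
    rw [hR, mul_div_cancel₀ _ (hn c)]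
  simp only [evenCoef, oddCoef]
  rw [show l - m - 1 + (b + ((c + 1 : ℕ) : ℤ)) = x by rw [hx]; push_cast; ring,
    show l - m + 1 - 1 + (b + (c : ℤ)) = x by rw [hx]; ring,
    show l - m + (b + ((c + 1 : ℕ) : ℤ)) = x + 1 by rw [hx]; push_cast; ring,
    show l - m + (b - 1 + ((c + 1 : ℕ) : ℤ)) = x by rw [hx]; push_cast; ring,
    show l - m + 1 + (b + (c : ℤ)) = x + 1 by rw [hx]; ring,
    show l - m + (b + (c : ℤ)) = x by rw [hx]; ring, r1, r2, r3,
    show x - c = l - m + b by rw [hx]; ring, hx]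
  simp only [vInt_sq]
  simp only [vInt]
  -- `v ^ e` carries the part of the exponents that is quadratic in the parameters
  obtain ⟨e, he⟩ : ∃ e : ℤ, e = -2 * (b + c) * (l - m + b + c) := ⟨_, rfl⟩
  rw [show -2 * (b + ((c + 1 : ℕ) : ℤ)) * (l - m + b + c + 1) + (b + ((c + 1 : ℕ) : ℤ)) =
      e + (m + m) - (l + l) - (b + b + b) - (c + c + c) - 1 by rw [he]; push_cast; ring,
    show -2 * (b + (c : ℤ)) * (l - m + b + c + 1) + (b + (c : ℤ)) = e - b - c by
        rw [he]; ring,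
    show -2 * (b + ((c + 1 : ℕ) : ℤ)) * (l - m + b + c + 1) + ((c + 1 : ℕ) : ℤ) =
      e + (m + m) - (l + l) - (b + b + b + b) - (c + c + c) - 1 by rw [he]; push_cast; ring,
    show -2 * (b - 1 + ((c + 1 : ℕ) : ℤ)) * (l - m + b + c) + ((c + 1 : ℕ) : ℤ) =
      e + c + 1 by rw [he]; push_cast; ring,
    show -2 * (b + (c : ℤ)) * (l - m + b + c) + (c : ℤ) = e + c by
      rw [he]]
  simp only [two_mul, zpow_add₀ hv, zpow_sub₀ hv, zpow_neg, zpow_one, div_eq_mul_inv _ (v - v⁻¹)]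
  have h1 := zpow_ne_zero e hv
  have h2 := zpow_ne_zero b hv
  have h3 := zpow_ne_zero m hv
  have h4 := zpow_ne_zero l hv
  have h5 := zpow_ne_zero (c : ℤ) hv
  generalize v ^ e = e' at *
  generalize v ^ b = b' at *
  generalize v ^ m = m' at *
  generalize v ^ l = l' at *
  generalize v ^ (c : ℤ) = c' at *
  generalize (v - v⁻¹)⁻¹ = D
  generalize (v ^ 2 - (v ^ 2)⁻¹)⁻¹ = D'
  field_simp
  ring

end Generic

/-! ### The field `ℚ(q)`, its bar involution and its subrings -/

theorem q_ne_zero : q ≠ 0 := RatFunc.X_ne_zero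

theorem q_pow_ne_one {n : ℕ} (hn : n ≠ 0) : q ^ n ≠ 1 := by
  intro h
  refine transcendental_q ⟨X ^ n - 1, ?_, by simp [h]⟩
  exact (monic_X_pow_sub_C (1 : ℚ) hn).ne_zero

theorem q_zpow_ne_one {n : ℤ} (hn : n ≠ 0) : q ^ n ≠ 1 := by
  obtain ⟨m, rfl | rfl⟩ := n.eq_nat_or_neg
  · simpa using q_pow_ne_one (by simpa using hn)
  · simpa using q_pow_ne_one (by simpa using hn)

theorem q_zpow_sub_ne_zero {n : ℤ} (hn : n ≠ 0) : q ^ n - q ^ (-n) ≠ 0 := by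
  intro h
  rw [sub_eq_zero] at h
  apply q_zpow_ne_one (n := n + n) (by omega)
  rw [zpow_add₀ q_ne_zero]
  nth_rw 1 [h]
  rw [← zpow_add₀ q_ne_zero]
  simp

theorem q_sub_inv_ne_zero : q - q⁻¹ ≠ 0 := by
  simpa using q_zpow_sub_ne_zero (n := 1) one_ne_zero

theorem qInt_eq_vInt (m : ℤ) : qInt m = vInt q m := rfl

theorem qInt_ne_zero {m : ℤ} (hm : m ≠ 0) : qInt m ≠ 0 :=
  div_ne_zero (q_zpow_sub_ne_zero hm) q_sub_inv_ne_zero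

theorem qInt_zero : qInt 0 = 0 := vInt_zero q

theorem qInt_one : qInt 1 = 1 := vInt_one q_sub_inv_ne_zero

theorem qInt_neg (m : ℤ) : qInt (-m) = -qInt m := vInt_neg q m

theorem qInt_succ_ne_zero (n : ℕ) : qInt ((n : ℤ) + 1) ≠ 0 := qInt_ne_zero (by omega)

theorem vInt_q_sq_ne_zero {m : ℤ} (hm : m ≠ 0) : vInt (q ^ 2) m ≠ 0 := by
  have h : ∀ n : ℤ, (q ^ 2) ^ n = q ^ (2 * n) := fun n => by rw [zpow_mul]; norm_cast
  have h1 : q ^ 2 - (q ^ 2)⁻¹ ≠ 0 := by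
    have := q_zpow_sub_ne_zero (n := 2) two_ne_zero
    rwa [zpow_neg] at this
  rw [vInt, h, h, mul_neg]
  exact div_ne_zero (q_zpow_sub_ne_zero (by omega)) h1

theorem qFact_zero : qFact 0 = 1 := by simp [qFact]

theorem qFact_succ (n : ℕ) : qFact (n + 1) = qFact n * qInt ((n : ℤ) + 1) := by
  rw [qFact, Finset.prod_range_succ, ← qFact]

theorem qFact_ne_zero (n : ℕ) : qFact n ≠ 0 :=
  Finset.prod_ne_zero_iff.mpr fun i _ => qInt_succ_ne_zero i

theorem bar_zpow_q (n : ℤ) : bar (q ^ n) = q ^ (-n) := by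
  rw [map_zpow₀, bar_q, inv_zpow, zpow_neg]

theorem bar_qInt (m : ℤ) : bar (qInt m) = qInt m := by
  rw [qInt, map_div₀, map_sub, map_sub, bar_zpow_q, bar_zpow_q, map_inv₀, bar_q, inv_inv, neg_neg,
    ← neg_sub, ← neg_sub q, neg_div_neg_eq]

theorem bar_qFact (n : ℕ) : bar (qFact n) = qFact n := by
  simp [qFact, map_prod, bar_qInt]

theorem q_mem_Aq : q ∈ Aq := Algebra.subset_adjoin (by simp)

theorem q_inv_mem_Aq : q⁻¹ ∈ Aq := Algebra.subset_adjoin (by simp)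

theorem q_zpow_mem_Aq (n : ℤ) : q ^ n ∈ Aq := by
  obtain ⟨n, rfl | rfl⟩ := n.eq_nat_or_neg
  · simpa using pow_mem q_mem_Aq n
  · simpa using pow_mem q_inv_mem_Aq n

theorem vBinom_q_mem_Aq (x : ℤ) (c : ℕ) : vBinom q x c ∈ Aq :=
  vBinom_mem Aq q_ne_zero q_mem_Aq q_inv_mem_Aq (fun c => qInt_succ_ne_zero c) c x

theorem vBinom_q_sq_mem_Aq (x : ℤ) (c : ℕ) : vBinom (q ^ 2) x c ∈ Aq :=
  vBinom_mem Aq (pow_ne_zero 2 q_ne_zero) (pow_mem q_mem_Aq 2)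
    (by rw [← inv_pow]; exact pow_mem q_inv_mem_Aq 2)
    (fun c => vInt_q_sq_ne_zero (by omega)) c x

theorem evenCoef_mem_Aq (d b : ℤ) (c : ℕ) : evenCoef q d b c ∈ Aq :=
  mul_mem (q_zpow_mem_Aq _) (vBinom_q_sq_mem_Aq _ _)

theorem oddCoef_mem_Aq (d b : ℤ) (c : ℕ) : oddCoef q d b c ∈ Aq :=
  mul_mem (q_zpow_mem_Aq _) (vBinom_q_sq_mem_Aq _ _)

theorem zero_mem_qInvN : (0 : Kq) ∈ qInvN := ⟨0, by simp⟩

theorem qInvN_subset_qInvZ : qInvN ⊆ qInvZ := by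
  rintro _ ⟨p, rfl⟩
  refine ⟨p.map (Nat.castRingHom ℤ), ?_⟩
  rw [aeval_def, aeval_def, eval₂_map]
  congr 2

theorem sub_mem_qInvZ {x y : Kq} (hx : x ∈ qInvZ) (hy : y ∈ qInvZ) : x - y ∈ qInvZ := by
  obtain ⟨p, rfl⟩ := hx
  obtain ⟨r, rfl⟩ := hy
  exact ⟨p - r, by rw [map_sub, mul_sub]⟩

theorem qInvZ_subset_Aq : qInvZ ⊆ (Aq : Set Kq) := by
  rintro _ ⟨p, rfl⟩
  refine mul_mem q_inv_mem_Aq ?_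
  have : aeval q⁻¹ p = ((aeval (⟨q⁻¹, q_inv_mem_Aq⟩ : Aq) p : Aq) : Kq) := by
    simp
  rw [this]
  exact Subtype.property _

/-- A bar-invariant element of `q⁻¹ ℤ[q⁻¹]` is zero. This is what makes canonical bases unique. -/
theorem eq_zero_of_mem_qInvZ_of_bar {x : Kq} (hx : x ∈ qInvZ) (hb : bar x = x) : x = 0 := by
  obtain ⟨p, rfl⟩ := hx
  have hbar : bar (aeval q⁻¹ p) = aeval q p := by
    rw [aeval_def, hom_eval₂, aeval_def, map_inv₀, bar_q, inv_inv]
    congr 1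
    exact RingHom.ext_int _ _
  rw [map_mul, hbar, map_inv₀, bar_q, inv_inv] at hb
  -- `q p(q) = q⁻¹ p(q⁻¹)`; multiplying by a power of `q` compares `p` with its reverse
  have hrev : aeval q p.reverse = q ^ p.natDegree * aeval q⁻¹ p := by
    let _ : Invertible q⁻¹ := ⟨q, mul_inv_cancel₀ q_ne_zero, inv_mul_cancel₀ q_ne_zero⟩
    have hu : eval₂ (algebraMap ℤ Kq) q p.reverse * q⁻¹ ^ p.natDegree =
      eval₂ (algebraMap ℤ Kq) q⁻¹ p := eval₂_reverse_mul_pow (algebraMap ℤ Kq) q⁻¹ p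
    rw [aeval_def, aeval_def, ← hu, mul_comm, mul_assoc, ← mul_pow, inv_mul_cancel₀ q_ne_zero]
    simp
  have hT : Function.Injective (aeval (R := ℤ) q) := by
    intro p r h
    apply map_injective (Int.castRingHom ℚ) Int.cast_injective
    apply transcendental_iff_injective.mp transcendental_q
    rw [aeval_def, aeval_def] at h ⊢
    rw [eval₂_map, eval₂_map]
    have e : (algebraMap ℚ Kq).comp (Int.castRingHom ℚ) = algebraMap ℤ Kq := RingHom.ext_int _ _
    rw [e]
    exact h
  have key : X ^ (p.natDegree + 2) * p = p.reverse := by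
    apply hT
    rw [map_mul, map_pow, aeval_X, hrev]
    have h2 : q ^ 2 * aeval q p = aeval q⁻¹ p := by
      rw [pow_two, mul_assoc, hb, mul_inv_cancel_left₀ q_ne_zero]
    rw [pow_add, mul_assoc, h2]
  by_contra h0
  have hp : p ≠ 0 := by
    rintro rfl
    simp at h0
  have h1 := congrArg natDegree key
  rw [natDegree_X_pow_mul _ hp] at h1
  have := reverse_natDegree_le p
  omega

/-- The subsemiring `ℕ[q⁻¹]` of `ℚ(q)`. -/
def NqInv : Subsemiring Kq := (aeval (R := ℕ) q⁻¹ : ℕ[X] →ₐ[ℕ] Kq).toRingHom.rangeS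

theorem q_inv_pow_mem_NqInv (n : ℕ) : q⁻¹ ^ n ∈ NqInv := ⟨X ^ n, by simp⟩

theorem q_zpow_mul_mem_qInvN {n : ℤ} (hn : n < 0) {x : Kq} (hx : x ∈ NqInv) :
    q ^ n * x ∈ qInvN := by
  obtain ⟨p, rfl⟩ := hx
  obtain ⟨k, rfl⟩ : ∃ k : ℕ, n = -((k : ℤ) + 1) := ⟨(-n - 1).toNat, by omega⟩
  refine ⟨X ^ k * p, ?_⟩
  rw [zpow_neg, zpow_add₀ q_ne_zero, zpow_one, zpow_natCast, mul_inv, mul_comm _ q⁻¹]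
  simp [mul_assoc]

/-- The Gaussian binomial `[k + c; c]` in `q²`, normalized to have constant term `1` as a
polynomial in `q⁻¹`, has natural number coefficients. -/
theorem normalized_vBinom_mem_NqInv (c k : ℕ) :
    q ^ (-2 * (c : ℤ) * k) * vBinom (q ^ 2) (k + c) c ∈ NqInv := by
  have hz : ∀ n : ℤ, (q ^ 2) ^ n = q ^ (2 * n) := fun n => by rw [zpow_mul]; norm_cast
  have hself : ∀ c : ℕ, vBinom (q ^ 2) c c = 1 := fun c => by
    induction c with
    | zero => exact vBinom_zero_right _ _
    | succ c ih =>
      have h0 : vInt (q ^ 2) ((c : ℤ) + 1) ≠ 0 := vInt_q_sq_ne_zero (by omega)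
      apply mul_right_cancel₀ h0
      rw [vBinom_succ_mul' _ h0]
      push_cast
      rw [add_sub_cancel_right, ih, mul_one, one_mul]
  induction c generalizing k with
  | zero => simp [vBinom_zero_right, one_mem]
  | succ c ihc =>
    induction k with
    | zero =>
      have := hself (c + 1)
      push_cast at this
      simp [this, one_mem]
    | succ k ihk =>
      have h := vBinom_pascal (pow_ne_zero 2 q_ne_zero) ((k : ℤ) + 1 + c)
        (c := c) (vInt_q_sq_ne_zero (by omega))
      have hq : q⁻¹ ^ (4 * (k + 1)) = q ^ (-(4 * ((k : ℤ) + 1))) := by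
        rw [zpow_neg, inv_pow]
        norm_cast
      have e : q ^ (-2 * ((c + 1 : ℕ) : ℤ) * ((k + 1 : ℕ) : ℤ)) *
            vBinom (q ^ 2) (((k + 1 : ℕ) : ℤ) + ((c + 1 : ℕ) : ℤ)) (c + 1) =
          q ^ (-2 * ((c + 1 : ℕ) : ℤ) * k) * vBinom (q ^ 2) (k + ((c + 1 : ℕ) : ℤ)) (c + 1) +
          q⁻¹ ^ (4 * (k + 1)) *
            (q ^ (-2 * (c : ℤ) * ((k + 1 : ℕ) : ℤ)) *
              vBinom (q ^ 2) (((k + 1 : ℕ) : ℤ) + c) c) := by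
        push_cast
        rw [show (k : ℤ) + 1 + (c + 1) = k + 1 + c + 1 by ring, h,
          show (k : ℤ) + (c + 1) = k + 1 + c by ring, mul_add, hz, hz, ← mul_assoc, ← mul_assoc,
          ← zpow_add₀ q_ne_zero, ← zpow_add₀ q_ne_zero, ← mul_assoc, hq,
          ← zpow_add₀ q_ne_zero]
        congr 3 <;> ring
      rw [e]
      exact add_mem ihk (mul_mem (q_inv_pow_mem_NqInv _) (ihc _))

/-- On a highest weight vector of weight `2l` with `m ≤ l`, the coefficients of the `ı`-divided
power of index `2m`, other than the leading one, lie in `q⁻¹ ℕ[q⁻¹]`. -/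
theorem evenCoef_mem_qInvN (k c : ℕ) : evenCoef q k 0 (c + 1) ∈ qInvN := by
  have h := q_zpow_mul_mem_qInvN (n := -(((c : ℤ) + 1) * (2 * c + 1)))
    (by rw [neg_lt_zero]; positivity) (normalized_vBinom_mem_NqInv (c + 1) k)
  convert h using 1
  rw [evenCoef, ← mul_assoc, ← zpow_add₀ q_ne_zero, zero_add]
  congr 2
  push_cast
  ring

/-- On a highest weight vector of weight `2l` with `m < l`, the coefficients of the `ı`-divided
power of index `2m + 1`, other than the leading one, lie in `q⁻¹ ℕ[q⁻¹]`. -/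
theorem oddCoef_mem_qInvN (k c : ℕ) : oddCoef q ((k : ℤ) + 1) 0 (c + 1) ∈ qInvN := by
  have h := q_zpow_mul_mem_qInvN (n := -(((c : ℤ) + 1) * (2 * c + 3)))
    (by rw [neg_lt_zero]; positivity) (normalized_vBinom_mem_NqInv (c + 1) k)
  convert h using 1
  rw [oddCoef, ← mul_assoc, ← zpow_add₀ q_ne_zero, zero_add, add_sub_cancel_right]
  congr 2
  push_cast
  ring

/-! ### The `ı`-divided powers as polynomials in `𝔱` -/

theorem evPoly_zero : evPoly 0 = 1 := by simp [evPoly]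

/-- The product `∏ (x - [2j])` over `-m ≤ j ≤ m`, common to the `ı`-divided powers of index
`2m + 1` and `2m + 2`. -/
def oddProd (m : ℕ) : Kq[X] :=
  ∏ i ∈ Finset.range (2 * m + 1), (X - C (qInt (2 * (i : ℤ) - 2 * m)))

theorem oddProd_succ (m : ℕ) :
    oddProd (m + 1) = (X ^ 2 - C (qInt (2 * (m : ℤ) + 2) ^ 2)) * oddProd m := by
  have h : ∀ i : ℕ, (2 * ((i + 1 : ℕ) : ℤ) - 2 * ((m + 1 : ℕ) : ℤ)) = 2 * i - 2 * m := fun i => by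
    push_cast; ring
  rw [oddProd, show 2 * (m + 1) + 1 = 2 * m + 1 + 1 + 1 by ring, Finset.prod_range_succ',
    Finset.prod_range_succ]
  simp only [h]
  rw [← oddProd]
  rw [show 2 * ((0 : ℕ) : ℤ) - 2 * ((m + 1 : ℕ) : ℤ) = -(2 * m + 2) by push_cast; ring,
    show 2 * ((2 * m + 1 : ℕ) : ℤ) - 2 * m = 2 * m + 2 by push_cast; ring, qInt_neg]
  simp only [map_neg, map_pow]
  ring

theorem evPoly_odd (m : ℕ) : evPoly (2 * m + 1) = C (qFact (2 * m + 1))⁻¹ * oddProd m := by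
  have h : ¬ Even (2 * m + 1) := by simp
  have h' : ∀ i : ℕ, 2 * (i : ℤ) - ((2 * m + 1 : ℕ) : ℤ) + 1 = 2 * i - 2 * m := fun i => by
    push_cast; ring
  simp only [evPoly, if_neg h, h', oddProd]
  simp

theorem evPoly_even_succ (m : ℕ) :
    evPoly (2 * m + 2) = C (qFact (2 * m + 2))⁻¹ * (X * oddProd m) := by
  have h : Even (2 * m + 2) := ⟨m + 1, by ring⟩
  have h' : ∀ i : ℕ, 2 * (i : ℤ) - ((2 * m + 2 : ℕ) : ℤ) + 2 = 2 * i - 2 * m := fun i => by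
    push_cast; ring
  simp only [evPoly, if_pos h, h', oddProd]
  simp

theorem X_mul_evPoly_odd (m : ℕ) :
    X * evPoly (2 * m + 1) = C (qInt (2 * m + 2)) * evPoly (2 * m + 2) := by
  have h : qFact (2 * m + 2) = qFact (2 * m + 1) * qInt (2 * m + 2) := by
    rw [qFact_succ (2 * m + 1)]; congr 2
  have h0 : qInt (2 * m + 2) ≠ 0 := qInt_ne_zero (by omega)
  rw [evPoly_odd, evPoly_even_succ, h, mul_inv, ← mul_assoc, ← mul_assoc, ← C_mul, mul_comm X,
    ← mul_assoc, mul_comm _ (qInt (2 * (m : ℤ) + 2))⁻¹, mul_inv_cancel_left₀ h0]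

theorem X_mul_evPoly_even (m : ℕ) :
    X * evPoly (2 * m) =
      C (qInt (2 * m + 1)) * evPoly (2 * m + 1) + C (qInt (2 * m)) * evPoly (2 * m - 1) := by
  cases m with
  | zero =>
    have := evPoly_odd 0
    simp [qFact, oddProd, qInt_zero, qInt_one] at this
    simp [evPoly_zero, qInt_zero, qInt_one, this]
  | succ m =>
    have h1 : qFact (2 * m + 2) = qFact (2 * m + 1) * qInt (2 * m + 2) := by
      rw [qFact_succ (2 * m + 1)]; congr 2
    have h2 : qFact (2 * m + 3) = qFact (2 * m + 1) * qInt (2 * m + 2) * qInt (2 * m + 3) := by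
      rw [qFact_succ (2 * m + 2), h1]; congr 2
    have h0 : qInt (2 * m + 2) ≠ 0 := qInt_ne_zero (by omega)
    have h0' : qInt (2 * m + 3) ≠ 0 := qInt_ne_zero (by omega)
    have e1 : evPoly (2 * (m + 1)) = evPoly (2 * m + 2) := rfl
    have e2 : evPoly (2 * (m + 1) + 1) = C (qFact (2 * m + 3))⁻¹ * oddProd (m + 1) :=
      evPoly_odd (m + 1)
    have e3 : evPoly (2 * (m + 1) - 1) = evPoly (2 * m + 1) := rfl
    rw [e1, e2, e3, evPoly_even_succ, evPoly_odd, oddProd_succ, h1, h2]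
    push_cast
    rw [show (2 * ((m : ℤ) + 1) + 1) = 2 * m + 3 by ring,
      show (2 * ((m : ℤ) + 1)) = 2 * m + 2 by ring]
    generalize qInt (2 * m + 2) = x at *
    generalize qInt (2 * m + 3) = y at *
    have hf := qFact_ne_zero (2 * m + 1)
    generalize qFact (2 * m + 1) = f at *
    have c1 : C y * C (f * x * y)⁻¹ = C (f * x)⁻¹ := by
      rw [← C_mul]; congr 1; field_simp
    have c2 : C x * C f⁻¹ = C (f * x)⁻¹ * C (x ^ 2) := by
      rw [← C_mul, ← C_mul]; congr 1; field_simp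
    rw [← mul_assoc (C y), c1, ← mul_assoc (C x), c2]
    ring

theorem map_bar_evPoly (n : ℕ) : (evPoly n).map bar = evPoly n := by
  unfold evPoly
  split_ifs <;>
    simp [Polynomial.map_mul, Polynomial.map_prod, bar_qInt, bar_qFact, Polynomial.map_sub]

/-! ### Weight vectors in `U`-modules -/

theorem Ki_mul_K : Ki * K = 1 := by
  simpa [K, Ki, ofGen] using RingQuot.mkAlgHom_rel Kq URel.Ki_K

theorem E_mul_F : E * F = F * E + (q - q⁻¹)⁻¹ • (K - Ki) := by
  have h := RingQuot.mkAlgHom_rel Kq URel.E_F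
  simp only [map_sub, map_mul, map_smul] at h
  exact sub_eq_iff_eq_add'.mp h

theorem K_mul_E : K * E = q ^ 2 • (E * K) := by
  have h := RingQuot.mkAlgHom_rel Kq URel.K_E
  simp only [map_mul, map_smul] at h
  exact h

theorem K_mul_F : K * F = (q ^ 2)⁻¹ • (F * K) := by
  have h := RingQuot.mkAlgHom_rel Kq URel.K_F
  simp only [map_mul, map_smul] at h
  exact h

theorem F_mul_Fdiv (n : ℕ) : F * Fdiv n = qInt ((n : ℤ) + 1) • Fdiv (n + 1) := by
  rw [Fdiv, Fdiv, qFact_succ, mul_smul_comm, smul_smul, ← pow_succ', mul_inv, mul_comm _⁻¹,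
    mul_inv_cancel_left₀ (qInt_succ_ne_zero n)]

theorem E_mul_Ediv (n : ℕ) : E * Ediv n = qInt ((n : ℤ) + 1) • Ediv (n + 1) := by
  rw [Ediv, Ediv, qFact_succ, mul_smul_comm, smul_smul, ← pow_succ', mul_inv, mul_comm _⁻¹,
    mul_inv_cancel_left₀ (qInt_succ_ne_zero n)]

theorem Fdiv_zero : Fdiv 0 = 1 := by simp [Fdiv, qFact_zero]

theorem Ediv_zero : Ediv 0 = 1 := by simp [Ediv, qFact_zero]

/-- The divided power `F⁽ᵃ⁾` for integral `a`, zero if `a < 0`. -/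
def FdivZ (a : ℤ) : U := if a < 0 then 0 else Fdiv a.toNat

theorem FdivZ_of_neg {a : ℤ} (h : a < 0) : FdivZ a = 0 := if_pos h

theorem FdivZ_natCast (n : ℕ) : FdivZ n = Fdiv n := by simp [FdivZ]

theorem F_mul_FdivZ (a : ℤ) : F * FdivZ a = qInt (a + 1) • FdivZ (a + 1) := by
  rcases lt_trichotomy a (-1) with h | rfl | h
  · rw [FdivZ_of_neg (by omega), FdivZ_of_neg (by omega), mul_zero, smul_zero]
  · rw [FdivZ_of_neg (by omega), neg_add_cancel, qInt_zero, mul_zero, zero_smul]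
  · lift a to ℕ using (by omega)
    rw [FdivZ_natCast, F_mul_Fdiv]
    exact congrArg _ (FdivZ_natCast (a + 1)).symm

section Weight

variable {M : Type*} [AddCommGroup M] [Module Kq M] [Module U M]

/-- `w` is a vector of weight `j`, that is, `K w = q^j w`. -/
def IsWt (j : ℤ) (w : M) : Prop := K • w = q ^ j • w

theorem IsWt.congr {i j : ℤ} {w : M} (h : IsWt i w) (e : i = j) : IsWt j w := e ▸ h

variable [IsScalarTower Kq U M]

theorem IsWt.Ki_smul {j : ℤ} {w : M} (h : IsWt j w) : Ki • w = q ^ (-j) • w := by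
  have h1 : Ki • (K • w) = w := by rw [← mul_smul, Ki_mul_K, one_smul]
  rw [h, smul_comm] at h1
  rw [zpow_neg, eq_inv_smul_iff₀ (zpow_ne_zero j q_ne_zero), h1]

theorem IsWt.smul {j : ℤ} {w : M} (h : IsWt j w) (c : Kq) : IsWt j (c • w) := by
  rw [IsWt, smul_comm, h, smul_comm]

theorem IsWt.E_smul {j : ℤ} {w : M} (h : IsWt j w) : IsWt (j + 2) (E • w) := by
  rw [IsWt, ← mul_smul, K_mul_E, smul_assoc, mul_smul, h, smul_comm E, smul_smul,
    zpow_add₀ q_ne_zero, mul_comm]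
  rfl

theorem IsWt.F_smul {j : ℤ} {w : M} (h : IsWt j w) : IsWt (j - 2) (F • w) := by
  rw [IsWt, ← mul_smul, K_mul_F, smul_assoc, mul_smul, h, smul_comm F, smul_smul,
    zpow_sub₀ q_ne_zero, div_eq_mul_inv, mul_comm]
  rfl

theorem IsWt.Ediv_smul {j : ℤ} {w : M} (h : IsWt j w) (n : ℕ) : IsWt (j + 2 * n) (Ediv n • w) := by
  rw [Ediv, smul_assoc]
  apply IsWt.smul
  induction n with
  | zero => simpa using h
  | succ n ih =>
    rw [pow_succ', mul_smul]
    exact ih.E_smul.congr (by push_cast; ring)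

theorem IsWt.Fdiv_smul {j : ℤ} {w : M} (h : IsWt j w) (n : ℕ) : IsWt (j - 2 * n) (Fdiv n • w) := by
  rw [Fdiv, smul_assoc]
  apply IsWt.smul
  induction n with
  | zero => simpa using h
  | succ n ih =>
    rw [pow_succ', mul_smul]
    exact ih.F_smul.congr (by push_cast; ring)

theorem IsWt.FdivZ_smul {j : ℤ} {w : M} (h : IsWt j w) (a : ℤ) :
    IsWt (j - 2 * a) (FdivZ a • w) := by
  rcases lt_or_ge a 0 with ha | ha
  · rw [FdivZ_of_neg ha, zero_smul, IsWt, smul_zero, smul_zero]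
  · lift a to ℕ using ha
    rw [FdivZ_natCast]
    exact h.Fdiv_smul a

theorem IsWt.E_F_smul {j : ℤ} {w : M} (h : IsWt j w) : E • F • w = F • E • w + qInt j • w := by
  rw [← mul_smul, E_mul_F, add_smul, mul_smul, smul_assoc, sub_smul, h, h.Ki_smul, ← sub_smul,
    smul_smul (q - q⁻¹)⁻¹, qInt, inv_mul_eq_div]

/-- The scalar identity behind `[E, Fⁿ⁺¹]`, in its inductive step. -/
theorem qInt_commutator (n j : ℤ) :
    qInt n * qInt (j - n + 1) + qInt (j - 2 * n) = qInt (n + 1) * qInt (j - n) := by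
  have h := q_sub_inv_ne_zero
  have hq := q_ne_zero
  simp only [qInt]
  field_simp
  simp only [two_mul, neg_add, neg_sub, zpow_add₀ hq, zpow_sub₀ hq, zpow_neg, zpow_one]
  have h1 := zpow_ne_zero n hq
  have h2 := zpow_ne_zero j hq
  generalize q ^ n = a at *
  generalize q ^ j = b at *
  generalize q = q at *
  field_simp
  ring

theorem IsWt.E_Fdiv_smul {j : ℤ} {w : M} (h : IsWt j w) (n : ℕ) :
    E • Fdiv (n + 1) • w = Fdiv (n + 1) • E • w + qInt (j - n) • Fdiv n • w := by
  induction n with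
  | zero =>
    have h1 : Fdiv (0 + 1) = F := by simp [Fdiv, qFact, qInt_one]
    rw [h1, h.E_F_smul, Fdiv_zero, one_smul]
    simp
  | succ n ih =>
    have h0 := qInt_succ_ne_zero (n + 1)
    have e : Fdiv (n + 1 + 1) = (qInt (((n + 1 : ℕ) : ℤ) + 1))⁻¹ • (F * Fdiv (n + 1)) := by
      rw [F_mul_Fdiv, inv_smul_smul₀ h0]
    have hc := qInt_commutator ((n : ℤ) + 1) j
    rw [e, smul_assoc, smul_assoc, smul_comm E, mul_smul, mul_smul, (h.Fdiv_smul (n + 1)).E_F_smul,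
      ih, smul_add F, smul_comm F (qInt _), ← mul_smul F (Fdiv n), F_mul_Fdiv,
      smul_assoc (qInt _), smul_smul (qInt _), smul_add, smul_add, smul_smul (_⁻¹ : Kq),
      smul_smul (_⁻¹ : Kq), add_assoc, ← add_smul]
    congr 2
    rw [← mul_add, inv_mul_eq_iff_eq_mul₀ h0]
    push_cast
    rw [← hc, mul_comm]
    congr 3
    ring

theorem IsWt.E_FdivZ_smul {j : ℤ} {w : M} (h : IsWt j w) (a : ℤ) :
    E • FdivZ a • w = FdivZ a • E • w + qInt (j - a + 1) • FdivZ (a - 1) • w := by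
  rcases lt_trichotomy a 0 with ha | rfl | ha
  · simp [FdivZ_of_neg ha, FdivZ_of_neg (show a - 1 < 0 by omega)]
  · simp [FdivZ, Fdiv_zero]
  · obtain ⟨n, rfl⟩ : ∃ n : ℕ, a = ((n + 1 : ℕ) : ℤ) := ⟨a.toNat - 1, by omega⟩
    have := h.E_Fdiv_smul n
    rw [FdivZ_natCast, show ((n + 1 : ℕ) : ℤ) - 1 = n by push_cast; ring, FdivZ_natCast, this,
      show j - ((n + 1 : ℕ) : ℤ) + 1 = j - n by push_cast; ring]

/-- The action of `𝔱` on the PBW vectors `F⁽ᵃ⁾ E⁽ᵇ⁾ w`, where `w` has weight `2l`. -/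
theorem IsWt.t_smul {l : ℤ} {w : M} (h : IsWt (2 * l) w) (a : ℤ) (b : ℕ) :
    t • FdivZ a • Ediv b • w =
      qInt (a + 1) • FdivZ (a + 1) • Ediv b • w +
      (q ^ (-1 - 2 * l - 2 * b + 2 * a) * qInt ((b : ℤ) + 1)) •
        FdivZ a • Ediv (b + 1) • w +
      (q ^ (-1 - 2 * l - 2 * b + 2 * a) * qInt (2 * l + 2 * b - a + 1)) •
        FdivZ (a - 1) • Ediv b • w := by
  have e : q⁻¹ * q ^ (-(2 * l + 2 * b - 2 * a)) = q ^ (-1 - 2 * l - 2 * b + 2 * a) := by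
    rw [← zpow_neg_one, ← zpow_add₀ q_ne_zero]
    congr 1
    ring
  rw [t, add_smul, smul_assoc, mul_smul, ((h.Ediv_smul b).FdivZ_smul a).Ki_smul, smul_comm E,
    smul_smul, e, (h.Ediv_smul b).E_FdivZ_smul, ← mul_smul E, E_mul_Ediv, smul_assoc, smul_comm _ (qInt _),
    ← mul_smul F, F_mul_FdivZ, smul_assoc, smul_add, smul_smul (_ : Kq), smul_smul (_ : Kq)]
  abel

end Weight

/-! ### The recursion for the `ı`-divided powers -/

theorem dvev_zero : dvev 0 = 1 := by simp [dvev, evPoly_zero]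

theorem tI_mul_dvev_even (m : ℕ) : tI * dvev (2 * m) =
    qInt (2 * m + 1) • dvev (2 * m + 1) + qInt (2 * m) • dvev (2 * m - 1) := by
  have := congrArg (aeval tI) (X_mul_evPoly_even m)
  simpa [dvev, Algebra.smul_def] using this

theorem tI_mul_dvev_odd (m : ℕ) :
    tI * dvev (2 * m + 1) = qInt (2 * m + 2) • dvev (2 * m + 2) := by
  have := congrArg (aeval tI) (X_mul_evPoly_odd m)
  simpa [dvev, Algebra.smul_def] using this

/-! ### The PBW expansion of the `ı`-divided powers -/

theorem sum_range_shift {A : Type*} [AddCommMonoid A] (f : ℕ → A) (N : ℕ) (h0 : f 0 = 0)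
    (hN : f N = 0) : ∑ i ∈ Finset.range N, f (i + 1) = ∑ i ∈ Finset.range N, f i := by
  have h := Finset.sum_range_succ' f N
  rw [Finset.sum_range_succ, h0, hN, add_zero, add_zero] at h
  exact h.symm

section Expansion

variable {M : Type*} [AddCommGroup M] [Module Kq M] [Module U M]

/-- The combination `∑ D(b, c) F⁽ⁿ⁻²ᶜ⁻ᵇ⁾ E⁽ᵇ⁾ w` over `b, c < N`. -/
def pbwSum (D : ℤ → ℕ → Kq) (n : ℤ) (N : ℕ) (w : M) : M :=
  ∑ c ∈ Finset.range N, ∑ b ∈ Finset.range N,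
    D b c • FdivZ (n - 2 * c - b) • Ediv b • w

theorem smul_pbwSum (x : Kq) (D : ℤ → ℕ → Kq) (n : ℤ) (N : ℕ) (w : M) :
    x • pbwSum D n N w = pbwSum (fun b c => x * D b c) n N w := by
  simp only [pbwSum, Finset.smul_sum, smul_smul]

/-- The coefficients of `𝔱 ∑ D(b, c) F⁽ⁿ⁻¹⁻²ᶜ⁻ᵇ⁾ E⁽ᵇ⁾ w` in the PBW vectors. -/
def tCoef (l n : ℤ) (D : ℤ → ℕ → Kq) (b : ℤ) (c : ℕ) : Kq :=
  qInt (n - 2 * c - b) * D b c +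
    q ^ (1 - 2 * l - 2 * b + 2 * (n - 2 * c - b)) * (qInt b * D (b - 1) c +
      qInt (2 * l + 2 * b - (n - 2 * c - b)) * if c = 0 then 0 else D b (c - 1))

theorem IsWt.t_smul_pbwSum [IsScalarTower Kq U M] {l : ℤ} {w : M} (h : IsWt (2 * l) w)
    (D : ℤ → ℕ → Kq) {n : ℤ} {N : ℕ} (hN : n + 1 < N) :
    t • pbwSum D n N w = pbwSum (tCoef l (n + 1) D) (n + 1) N w := by
  -- the terms `F⁽ᵃ⁾ E⁽ᵇ⁺¹⁾ w` are reindexed by `b`, the terms `F⁽ᵃ⁻¹⁾ E⁽ᵇ⁾ w` by `c`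
  have h2 : ∀ c : ℕ, ∑ b ∈ Finset.range N,
      (D b c * (q ^ (-1 - 2 * l - 2 * b + 2 * (n - 2 * c - b)) * qInt ((b : ℤ) + 1))) •
        FdivZ (n - 2 * c - b) • Ediv (b + 1) • w =
      ∑ b ∈ Finset.range N, (q ^ (1 - 2 * l - 2 * b + 2 * (n + 1 - 2 * c - b)) *
        (qInt b * D (b - 1) c)) • FdivZ (n + 1 - 2 * c - b) • Ediv b • w := by
    intro c
    rw [← sum_range_shift (fun b : ℕ => (q ^ (1 - 2 * l - 2 * b + 2 * (n + 1 - 2 * c - b)) *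
        (qInt b * D (b - 1) c)) • FdivZ (n + 1 - 2 * c - b) • Ediv b • w)]
    · refine Finset.sum_congr rfl fun b _ => ?_
      push_cast
      rw [show (1 - 2 * l - 2 * ((b : ℤ) + 1) + 2 * (n + 1 - 2 * c - (b + 1))) =
        -1 - 2 * l - 2 * b + 2 * (n - 2 * c - b) by ring, add_sub_cancel_right,
        show n + 1 - 2 * c - ((b : ℤ) + 1) = n - 2 * c - b by ring]
      congr 1
      ring
    · simp [qInt_zero]
    · rw [FdivZ_of_neg (by omega), zero_smul, smul_zero]
  have h3 : ∑ c ∈ Finset.range N, ∑ b ∈ Finset.range N,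
      (D b c * (q ^ (-1 - 2 * l - 2 * b + 2 * (n - 2 * c - b)) *
        qInt (2 * l + 2 * b - (n - 2 * c - b) + 1))) •
        FdivZ (n - 2 * c - b - 1) • Ediv b • w =
      ∑ c ∈ Finset.range N, ∑ b ∈ Finset.range N,
        (q ^ (1 - 2 * l - 2 * b + 2 * (n + 1 - 2 * c - b)) *
          (qInt (2 * l + 2 * b - (n + 1 - 2 * c - b)) * if c = 0 then 0 else D b (c - 1))) •
          FdivZ (n + 1 - 2 * c - b) • Ediv b • w := by
    rw [← sum_range_shift (fun c : ℕ => ∑ b ∈ Finset.range N,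
        (q ^ (1 - 2 * l - 2 * b + 2 * (n + 1 - 2 * c - b)) *
          (qInt (2 * l + 2 * b - (n + 1 - 2 * c - b)) * if c = 0 then 0 else D b (c - 1))) •
          FdivZ (n + 1 - 2 * c - b) • Ediv b • w)]
    · refine Finset.sum_congr rfl fun c _ => Finset.sum_congr rfl fun b _ => ?_
      rw [if_neg (Nat.succ_ne_zero c), Nat.add_sub_cancel]
      push_cast
      rw [show (1 - 2 * l - 2 * (b : ℤ) + 2 * (n + 1 - 2 * (c + 1) - b)) =
          -1 - 2 * l - 2 * b + 2 * (n - 2 * c - b) by ring,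
        show n + 1 - 2 * ((c : ℤ) + 1) - b = n - 2 * c - b - 1 by ring,
        show 2 * l + 2 * (b : ℤ) - (n - 2 * c - b) + 1 = 2 * l + 2 * b - (n - 2 * c - b - 1) by
          ring]
      congr 1
      ring
    · simp
    · refine Finset.sum_eq_zero fun b _ => ?_
      rw [FdivZ_of_neg (by omega), zero_smul, smul_zero]
  have h1 : t • pbwSum D n N w = ∑ c ∈ Finset.range N, ∑ b ∈ Finset.range N,
      ((D b c * qInt (n - 2 * c - b + 1)) •
          FdivZ (n - 2 * c - b + 1) • Ediv b • w +
        (D b c * (q ^ (-1 - 2 * l - 2 * b + 2 * (n - 2 * c - b)) * qInt ((b : ℤ) + 1))) •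
          FdivZ (n - 2 * c - b) • Ediv (b + 1) • w +
        (D b c * (q ^ (-1 - 2 * l - 2 * b + 2 * (n - 2 * c - b)) *
          qInt (2 * l + 2 * b - (n - 2 * c - b) + 1))) •
          FdivZ (n - 2 * c - b - 1) • Ediv b • w) := by
    rw [pbwSum, Finset.smul_sum]
    refine Finset.sum_congr rfl fun c _ => ?_
    rw [Finset.smul_sum]
    refine Finset.sum_congr rfl fun b _ => ?_
    rw [smul_comm t, h.t_smul, smul_add, smul_add, smul_smul (D b c), smul_smul (D b c),
      smul_smul (D b c)]
  simp only [Finset.sum_add_distrib] at h1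
  rw [h3, Finset.sum_congr rfl fun c _ => h2 c] at h1
  rw [h1]
  simp only [pbwSum, tCoef, ← Finset.sum_add_distrib]
  refine Finset.sum_congr rfl fun c _ => Finset.sum_congr rfl fun b _ => ?_
  rw [show n - 2 * (c : ℤ) - b + 1 = n + 1 - 2 * c - b by ring, ← add_smul, ← add_smul]
  congr 1
  ring

theorem vInt_q_sq_succ_ne_zero (c : ℕ) : vInt (q ^ 2) ((c : ℤ) + 1) ≠ 0 :=
  vInt_q_sq_ne_zero (by omega)

theorem tCoef_oddCoef (l m b : ℤ) (c : ℕ) :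
    tCoef l (2 * m + 2) (oddCoef q (l - m)) b c =
      qInt (2 * m + 2) * evenCoef q (l - m - 1) b c := by
  cases c with
  | zero =>
    have h := oddCoef_step_zero q_ne_zero l m b
    simp only [tCoef, qInt_eq_vInt, h]
    simp
  | succ c =>
    have h := oddCoef_step_succ q_ne_zero vInt_q_sq_succ_ne_zero l m b c
    have e : 2 * m + 2 - 2 * ((c + 1 : ℕ) : ℤ) - b = 2 * m - 2 * c - b := by push_cast; ring
    simp only [tCoef, qInt_eq_vInt, h, e]
    simp

theorem tCoef_evenCoef_zero (l m b : ℤ) :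
    tCoef l (2 * m + 1) (evenCoef q (l - m)) b 0 = qInt (2 * m + 1) * oddCoef q (l - m) b 0 := by
  have h := evenCoef_step_zero q_ne_zero l m b
  simp only [tCoef, qInt_eq_vInt, h]
  simp

theorem tCoef_evenCoef_succ (l m b : ℤ) (c : ℕ) :
    tCoef l (2 * m + 1) (evenCoef q (l - m)) b (c + 1) =
      qInt (2 * m + 1) * oddCoef q (l - m) b (c + 1) +
        qInt (2 * m) * oddCoef q (l - m + 1) b c := by
  have h := evenCoef_step_succ q_ne_zero vInt_q_sq_succ_ne_zero l m b c
  have e : 2 * m + 1 - 2 * ((c + 1 : ℕ) : ℤ) - b = 2 * m - 1 - 2 * c - b := by push_cast; ring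
  simp only [tCoef, qInt_eq_vInt, h, e]
  simp

end Expansion

/-- Induction along the recursion of the `ı`-divided powers. -/
theorem dvev_induction {P : ℕ → Prop} (h0 : P 0)
    (hodd : ∀ m, P (2 * m) → (m = 0 ∨ P (2 * m - 1)) → P (2 * m + 1))
    (heven : ∀ m, P (2 * m + 1) → P (2 * m + 2)) (n : ℕ) : P n := by
  have h : ∀ m, P (2 * m) ∧ P (2 * m + 1) := by
    intro m
    induction m with
    | zero => exact ⟨h0, hodd 0 h0 (Or.inl rfl)⟩
    | succ m ih =>
      have h2 := heven m ih.2
      exact ⟨h2, hodd (m + 1) h2 (Or.inr ih.2)⟩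
  obtain ⟨m, rfl | rfl⟩ := n.even_or_odd'
  exacts [(h m).1, (h m).2]

section Expansion

variable {M : Type*} [AddCommGroup M] [Module Kq M] [Module U M]

theorem pbwSum_add (D D' : ℤ → ℕ → Kq) (n : ℤ) (N : ℕ) (w : M) :
    pbwSum D n N w + pbwSum D' n N w = pbwSum (fun b c => D b c + D' b c) n N w := by
  simp only [pbwSum, ← Finset.sum_add_distrib, add_smul]

/-- Reindexing `c`, so that a sum for `n` is compared with sums for `n + 2`. -/
theorem pbwSum_shift (D : ℤ → ℕ → Kq) {n : ℤ} {N : ℕ} (h : n + 2 < 2 * N) (w : M) :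
    pbwSum (fun b c => if c = 0 then 0 else D b (c - 1)) (n + 2) N w = pbwSum D n N w := by
  rw [pbwSum, ← sum_range_shift]
  · refine Finset.sum_congr rfl fun c _ => Finset.sum_congr rfl fun b _ => ?_
    rw [if_neg (Nat.succ_ne_zero c), Nat.add_sub_cancel]
    push_cast
    rw [show n + 2 - 2 * ((c : ℤ) + 1) - b = n - 2 * c - b by ring]
  · simp
  · refine Finset.sum_eq_zero fun b _ => ?_
    rw [FdivZ_of_neg (by omega), zero_smul, smul_zero]

theorem pbwSum_zero (D : ℤ → ℕ → Kq) {N : ℕ} (hN : 0 < N) (w : M) :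
    pbwSum D 0 N w = D 0 0 • w := by
  have h0 : 0 ∈ Finset.range N := Finset.mem_range.mpr hN
  rw [pbwSum, Finset.sum_eq_single_of_mem 0 h0, Finset.sum_eq_single_of_mem 0 h0]
  · simp [FdivZ, Fdiv_zero, Ediv_zero]
  · intro b _ hb
    rw [FdivZ_of_neg (by omega), zero_smul, smul_zero]
  · intro c _ hc
    refine Finset.sum_eq_zero fun b _ => ?_
    rw [FdivZ_of_neg (by omega), zero_smul, smul_zero]

/-- The coefficient of `F⁽ⁿ⁻²ᶜ⁻ᵇ⁾ E⁽ᵇ⁾` in `𝔱⁽ⁿ⁾_ev` on weight `2l`. -/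
def pbwCoef (l : ℤ) (n : ℕ) (b : ℤ) (c : ℕ) : Kq :=
  if Even n then evenCoef q (l - (n / 2 : ℕ)) b c else oddCoef q (l - (n / 2 : ℕ)) b c

theorem pbwCoef_even (l : ℤ) (m : ℕ) : pbwCoef l (2 * m) = evenCoef q (l - m) := by
  funext b c
  rw [pbwCoef, if_pos (even_two_mul m), Nat.mul_div_cancel_left m two_pos]

theorem pbwCoef_odd (l : ℤ) (m : ℕ) : pbwCoef l (2 * m + 1) = oddCoef q (l - m) := by
  funext b c
  rw [pbwCoef, if_neg (by simp), show (2 * m + 1) / 2 = m by omega]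

theorem pbwCoef_mem_Aq (l : ℤ) (n : ℕ) (b : ℤ) (c : ℕ) : pbwCoef l n b c ∈ Aq := by
  rw [pbwCoef]
  split_ifs
  exacts [evenCoef_mem_Aq _ _ _, oddCoef_mem_Aq _ _ _]

theorem pbwCoef_zero_zero (l : ℤ) (n : ℕ) : pbwCoef l n 0 0 = 1 := by
  rw [pbwCoef]
  split_ifs <;> simp [evenCoef, oddCoef, vBinom_zero_right]

theorem t_smul_dvev_even [IsScalarTower Kq U M] (m : ℕ) (w : M) : t • dvev (2 * m) • w =
    qInt (2 * m + 1) • dvev (2 * m + 1) • w + qInt (2 * m) • dvev (2 * m - 1) • w := by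
  have h : tI • dvev (2 * m) • w = _ := smul_smul tI _ w
  rw [tI_mul_dvev_even, add_smul, smul_assoc, smul_assoc] at h
  exact h

theorem t_smul_dvev_odd [IsScalarTower Kq U M] (m : ℕ) (w : M) :
    t • dvev (2 * m + 1) • w = qInt (2 * m + 2) • dvev (2 * m + 2) • w := by
  have h : tI • dvev (2 * m + 1) • w = _ := smul_smul tI _ w
  rw [tI_mul_dvev_odd, smul_assoc] at h
  exact h

/-- The PBW expansion of the `ı`-divided powers on vectors of even weight. -/
theorem IsWt.dvev_smul [IsScalarTower Kq U M] {l : ℤ} {w : M} (h : IsWt (2 * l) w) {n N : ℕ}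
    (hN : n < N) : dvev n • w = pbwSum (pbwCoef l n) n N w := by
  induction n using dvev_induction with
  | h0 =>
    rw [dvev_zero, one_smul]
    exact (by rw [pbwCoef_zero_zero, one_smul] : w = pbwCoef l 0 0 0 • w).trans
      (pbwSum_zero _ hN w).symm
  | hodd m h1 h2 =>
    have h0 : qInt (2 * m + 1) ≠ 0 := qInt_ne_zero (by omega)
    have hT := t_smul_dvev_even m w
    rw [h1 (by omega), h.t_smul_pbwSum _ (by push_cast; omega), pbwCoef_even] at hT
    have e : qInt (2 * m) • dvev (2 * m - 1) • w =
        pbwSum (fun b c => qInt (2 * m) * if c = 0 then 0 else oddCoef q (l - m + 1) b (c - 1))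
          (2 * m + 1) N w := by
      rcases h2 with rfl | h2
      · simp [qInt_zero, pbwSum]
      · rcases m with _ | m
        · simp [qInt_zero, pbwSum]
        · rw [h2 (by omega), show 2 * (m + 1) - 1 = 2 * m + 1 by omega, pbwCoef_odd,
            ← smul_pbwSum,
            show (2 * ((m + 1 : ℕ) : ℤ) + 1) = ((2 * m + 1 : ℕ) : ℤ) + 2 by push_cast; ring,
            pbwSum_shift _ (by push_cast; omega),
            show l - ((m + 1 : ℕ) : ℤ) + 1 = l - m by push_cast; ring]
    apply smul_right_injective M h0
    beta_reduce
    rw [← add_right_cancel_iff (a := qInt (2 * m) • dvev (2 * m - 1) • w), ← hT, e, pbwCoef_odd,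
      smul_pbwSum]
    push_cast
    rw [pbwSum_add]
    congr 1
    funext b c
    cases c with
    | zero => rw [tCoef_evenCoef_zero]; simp
    | succ c => rw [tCoef_evenCoef_succ]; simp
  | heven m h1 =>
    have h0 : qInt (2 * m + 2) ≠ 0 := qInt_ne_zero (by omega)
    have hT := t_smul_dvev_odd m w
    rw [h1 (by omega), h.t_smul_pbwSum _ (by push_cast; omega), pbwCoef_odd] at hT
    apply smul_right_injective M h0
    beta_reduce
    rw [← hT, show 2 * m + 2 = 2 * (m + 1) by ring, pbwCoef_even, smul_pbwSum]
    push_cast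
    rw [show (2 * (m : ℤ) + 1 + 1) = 2 * m + 2 by ring,
      show 2 * ((m : ℤ) + 1) = 2 * m + 2 by ring]
    congr 1
    funext b c
    rw [tCoef_oddCoef, sub_add_eq_sub_sub]

/-- On a highest weight vector only the terms without `E` survive. -/
theorem IsWt.dvev_smul_of_E_smul_eq_zero [IsScalarTower Kq U M] {l : ℤ} {w : M}
    (h : IsWt (2 * l) w) (hE : E • w = 0) {n N : ℕ} (hN : n < N) :
    dvev n • w = ∑ c ∈ Finset.range N, pbwCoef l n 0 c • FdivZ (n - 2 * c) • w := by
  rw [h.dvev_smul hN, pbwSum]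
  refine Finset.sum_congr rfl fun c _ => ?_
  rw [Finset.sum_eq_single_of_mem 0 (Finset.mem_range.mpr (by omega))]
  · simp [Ediv_zero]
  · intro b _ hb
    obtain ⟨b, rfl⟩ := Nat.exists_eq_succ_of_ne_zero hb
    rw [Ediv, smul_assoc, Nat.succ_eq_add_one, pow_succ, mul_smul, hE]
    simp

theorem vBinom_eq_zero (v : Kq) (c : ℕ) : vBinom v c (c + 1) = 0 := by
  rw [vBinom, Finset.prod_range_succ]
  simp [vInt_zero]

/-- The `ı`-divided powers of index larger than `2l` kill a highest weight vector of weight `2l`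
which is killed by `F⁽²ˡ⁺¹⁾`. -/
theorem IsWt.dvev_smul_eq_zero [IsScalarTower Kq U M] {l : ℕ} {w : M}
    (h : IsWt (2 * l) w) (hE : E • w = 0) (hF : Fdiv (2 * l + 1) • w = 0) {n : ℕ} (hn : 2 * l < n) :
    dvev n • w = 0 := by
  have h1 : dvev (2 * l + 1) • w = 0 := by
    rw [h.dvev_smul_of_E_smul_eq_zero hE (Nat.lt_succ_self _)]
    refine Finset.sum_eq_zero fun c _ => ?_
    cases c with
    | zero =>
      rw [Nat.cast_zero, mul_zero, sub_zero, FdivZ_natCast, hF, smul_zero]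
    | succ c =>
      rw [pbwCoef_odd, oddCoef]
      push_cast
      rw [show (l : ℤ) - l - 1 + (0 + (c + 1)) = c by ring, vBinom_eq_zero, mul_zero, zero_smul]
  have hstep : ∀ m, dvev (2 * m + 1) • w = 0 → dvev (2 * m + 2) • w = 0 := by
    intro m hm
    have := t_smul_dvev_odd m w
    rw [hm, smul_zero] at this
    exact (smul_eq_zero.mp this.symm).resolve_left (qInt_ne_zero (by omega))
  have hall : ∀ m, dvev (2 * (l + m) + 1) • w = 0 := by
    intro m
    induction m with
    | zero => exact h1
    | succ m ih =>
      have h2 : dvev (2 * (l + (m + 1))) • w = 0 := hstep _ ih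
      have := t_smul_dvev_even (l + (m + 1)) w
      rw [h2, show 2 * (l + (m + 1)) - 1 = 2 * (l + m) + 1 by omega, ih, smul_zero, smul_zero,
        add_zero] at this
      exact (smul_eq_zero.mp this.symm).resolve_left (qInt_ne_zero (by omega))
  obtain ⟨k, rfl⟩ := Nat.exists_eq_add_of_lt hn
  obtain ⟨m, rfl | rfl⟩ := k.even_or_odd'
  · rw [← mul_add]
    exact hall m
  · rw [show 2 * l + (2 * m + 1) + 1 = 2 * (l + m) + 2 by ring]
    exact hstep _ (hall m)

/-- Unitriangularity and positivity of the `ı`-divided powers on a highest weight vector. -/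
theorem IsWt.exists_dvev_smul_eq [IsScalarTower Kq U M] {l : ℕ} {w : M}
    (h : IsWt (2 * l) w) (hE : E • w = 0) {n : ℕ} (hn : n ≤ 2 * l) :
    ∃ d : ℕ → Kq, (∀ r, d r ∈ qInvN) ∧
      dvev n • w = Fdiv n • w + ∑ r ∈ Finset.range n, d r • Fdiv r • w := by
  rw [h.dvev_smul_of_E_smul_eq_zero hE (Nat.lt_succ_self n), Finset.sum_range_succ', add_comm]
  rw [Nat.cast_zero, mul_zero, sub_zero, FdivZ_natCast, pbwCoef_zero_zero, one_smul]
  simp only [add_right_inj]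
  refine Finset.sum_induction (fun c : ℕ => pbwCoef l n 0 (c + 1) •
    FdivZ (n - 2 * ((c + 1 : ℕ) : ℤ)) • w) (fun y => ∃ d : ℕ → Kq, (∀ r, d r ∈ qInvN) ∧
      y = ∑ r ∈ Finset.range n, d r • Fdiv r • w) ?_ ?_ ?_
  · rintro _ _ ⟨d, hd, rfl⟩ ⟨d', hd', rfl⟩
    refine ⟨fun r => d r + d' r, fun r => ?_, ?_⟩
    · obtain ⟨p, hp⟩ := hd r
      obtain ⟨p', hp'⟩ := hd' r
      exact ⟨p + p', by beta_reduce; rw [hp, hp', map_add, mul_add]⟩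
    · simp only [add_smul, Finset.sum_add_distrib]
  · exact ⟨0, fun _ => zero_mem_qInvN, by simp⟩
  · intro c _
    rcases lt_or_ge ((n : ℤ) - 2 * ((c + 1 : ℕ) : ℤ)) 0 with hc | hc
    · exact ⟨0, fun _ => zero_mem_qInvN, by rw [FdivZ_of_neg hc]; simp⟩
    · obtain ⟨r, hr⟩ := Int.eq_ofNat_of_zero_le hc
      refine ⟨Pi.single r (pbwCoef l n 0 (c + 1)), fun s => ?_, ?_⟩
      · rcases eq_or_ne s r with rfl | hs
        · rw [Pi.single_eq_same]
          obtain ⟨m, rfl | rfl⟩ := n.even_or_odd'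
          · rw [pbwCoef_even, show (l : ℤ) - m = ((l - m : ℕ) : ℤ) by omega]
            exact evenCoef_mem_qInvN _ _
          · rw [pbwCoef_odd, show (l : ℤ) - m = ((l - m - 1 : ℕ) : ℤ) + 1 by omega]
            exact oddCoef_mem_qInvN _ _
        · rw [Pi.single_eq_of_ne hs]
          exact zero_mem_qInvN
      · rw [Finset.sum_eq_single_of_mem r (Finset.mem_range.mpr (by omega)), Pi.single_eq_same, hr,
          FdivZ_natCast]
        intro s _ hs
        rw [Pi.single_eq_of_ne hs, zero_smul]

theorem Fdiv_smul_FdivZ [IsScalarTower Kq U M] (k : ℕ) (a : ℤ) (w : M) :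
    Fdiv k • FdivZ a • w = vBinom q (a + k) k • FdivZ (a + k) • w := by
  induction k with
  | zero => simp [Fdiv_zero, vBinom_zero_right]
  | succ k ih =>
    have h0 := qInt_succ_ne_zero k
    have h1 := vBinom_succ_mul' (v := q) (a + k + 1) h0
    apply smul_right_injective M h0
    beta_reduce
    rw [← smul_assoc, ← F_mul_Fdiv, mul_smul, ih, smul_comm F, ← mul_smul F, F_mul_FdivZ,
      smul_assoc, smul_smul, smul_smul]
    push_cast
    rw [← add_assoc, mul_comm (qInt _) (vBinom _ _ _), mul_comm]
    congr 1
    rw [qInt_eq_vInt, qInt_eq_vInt, h1, add_sub_cancel_right]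

theorem IsWt.Ediv_smul_FdivZ [IsScalarTower Kq U M] {j : ℤ} {w : M} (h : IsWt j w)
    (hE : E • w = 0) (k : ℕ) (a : ℤ) :
    Ediv k • FdivZ a • w = vBinom q (j - a + k) k • FdivZ (a - k) • w := by
  induction k with
  | zero => simp [Ediv_zero, vBinom_zero_right]
  | succ k ih =>
    have h0 := qInt_succ_ne_zero k
    have h1 := vBinom_succ_mul' (v := q) (j - a + k + 1) h0
    apply smul_right_injective M h0
    beta_reduce
    rw [← smul_assoc, ← E_mul_Ediv, mul_smul, ih, smul_comm E, h.E_FdivZ_smul, hE, smul_zero,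
      zero_add, smul_smul, smul_smul]
    push_cast
    rw [← add_assoc, mul_comm (qInt _) (vBinom _ _ _), mul_comm, sub_add_eq_sub_sub a]
    congr 1
    rw [qInt_eq_vInt, qInt_eq_vInt, h1, add_sub_cancel_right,
      show j - (a - (k : ℤ)) + 1 = j - a + k + 1 by ring]

end Expansion

/-! ### The modules `L(μ)` -/

/-- A subalgebra of `U` containing the generators is everything. -/
theorem eq_top_of_ofGen_mem (S : Subalgebra Kq U) (h : ∀ x, ofGen x ∈ S) : S = ⊤ := by
  rw [eq_top_iff]
  rintro u -
  obtain ⟨a, rfl⟩ := RingQuot.mkAlgHom_surjective Kq URel u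
  induction a using FreeAlgebra.induction with
  | grade0 r => rw [AlgHom.commutes]; exact S.algebraMap_mem r
  | grade1 x => exact h x
  | mul a b ha hb => rw [map_mul]; exact S.mul_mem ha hb
  | add a b ha hb => rw [map_add]; exact S.add_mem ha hb

theorem mk_eq_smul_vPlus (μ : ℕ) (u : U) : (Submodule.Quotient.mk u : L μ) = u • vPlus μ := by
  rw [vPlus, ← Submodule.Quotient.mk_smul, smul_eq_mul, mul_one]

theorem smul_vPlus_eq_zero {μ : ℕ} {u : U} : u • vPlus μ = 0 ↔ u ∈ LIdeal μ := by
  rw [← mk_eq_smul_vPlus, Submodule.Quotient.mk_eq_zero]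

theorem E_smul_vPlus (μ : ℕ) : E • vPlus μ = 0 :=
  smul_vPlus_eq_zero.mpr (Submodule.subset_span (by simp))

theorem K_smul_vPlus (μ : ℕ) : K • vPlus μ = q ^ μ • vPlus μ := by
  have h : (K - algebraMap Kq U (q ^ μ)) • vPlus μ = 0 :=
    smul_vPlus_eq_zero.mpr (Submodule.subset_span (by simp))
  rwa [sub_smul, algebraMap_smul, sub_eq_zero] at h

theorem isWt_vPlus (μ : ℕ) : IsWt μ (vPlus μ) := by
  rw [IsWt, zpow_natCast]
  exact K_smul_vPlus μ

theorem Fdiv_smul_vPlus_eq_zero {μ n : ℕ} (h : μ < n) : Fdiv n • vPlus μ = 0 := by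
  have h0 : F ^ (μ + 1) • vPlus μ = 0 :=
    smul_vPlus_eq_zero.mpr (Submodule.subset_span (by simp))
  obtain ⟨k, rfl⟩ := Nat.exists_eq_add_of_lt h
  rw [Fdiv, smul_assoc, show μ + k + 1 = k + (μ + 1) by ring, pow_add, mul_smul, h0, smul_zero]
  exact smul_zero (M := Kq) (A := L μ) _

/-- The span of the canonical basis of `L(μ)` over a subring of scalars contains all divided powers
`F⁽ⁿ⁾ v⁺`, as those with `n > μ` vanish. -/
theorem FdivZ_smul_vPlus_mem {R : Type*} [Semiring R] (μ : ℕ) [Module R (L μ)] (a : ℤ) :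
    FdivZ a • vPlus μ ∈ Submodule.span R (Set.range (canL μ)) := by
  rcases lt_or_ge a 0 with ha | ha
  · rw [FdivZ_of_neg ha, zero_smul]
    exact Submodule.zero_mem _
  · lift a to ℕ using ha
    rw [FdivZ_natCast]
    rcases lt_or_ge μ a with h | h
    · rw [Fdiv_smul_vPlus_eq_zero h]
      exact Submodule.zero_mem _
    · exact Submodule.subset_span ⟨⟨a, Nat.lt_succ_of_le h⟩, rfl⟩

theorem canL_eq_FdivZ (μ : ℕ) (a : Fin (μ + 1)) : canL μ a = FdivZ (a : ℕ) • vPlus μ := by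
  rw [FdivZ_natCast, canL]

theorem span_canL (μ : ℕ) : Submodule.span Kq (Set.range (canL μ)) = ⊤ := by
  set S := Submodule.span Kq (Set.range (canL μ)) with hS
  -- the elements of `U` preserving the span form a subalgebra containing the generators
  have key : ∀ u : U, (∀ a, u • canL μ a ∈ S) → ∀ x ∈ S, u • x ∈ S := by
    intro u hu x hx
    induction hx using Submodule.span_induction with
    | mem x hx => obtain ⟨a, rfl⟩ := hx; exact hu a
    | zero => rw [smul_zero]; exact S.zero_mem
    | add x y _ _ hx hy => rw [smul_add]; exact S.add_mem hx hy
    | smul c x _ hx => rw [smul_comm]; exact S.smul_mem c hx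
  let A : Subalgebra Kq U :=
    { carrier := {u | ∀ x ∈ S, u • x ∈ S}
      mul_mem' := fun {u v} hu hv x hx => by rw [mul_smul]; exact hu _ (hv x hx)
      add_mem' := fun {u v} hu hv x hx => by rw [add_smul]; exact S.add_mem (hu x hx) (hv x hx)
      algebraMap_mem' := fun c x hx => by rw [algebraMap_smul]; exact S.smul_mem c hx }
  have hA : A = ⊤ := by
    refine eq_top_of_ofGen_mem A fun x => key _ fun a => ?_
    rw [canL_eq_FdivZ]
    cases x with
    | E =>
      change E • _ ∈ S
      rw [(isWt_vPlus μ).E_FdivZ_smul, E_smul_vPlus, smul_zero, zero_add]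
      exact S.smul_mem _ (FdivZ_smul_vPlus_mem μ _)
    | F =>
      change F • _ ∈ S
      rw [← mul_smul, F_mul_FdivZ, smul_assoc]
      exact S.smul_mem _ (FdivZ_smul_vPlus_mem μ _)
    | K =>
      change K • _ ∈ S
      rw [((isWt_vPlus μ).FdivZ_smul _)]
      exact S.smul_mem _ (FdivZ_smul_vPlus_mem μ _)
    | Ki =>
      change Ki • _ ∈ S
      rw [((isWt_vPlus μ).FdivZ_smul _).Ki_smul]
      exact S.smul_mem _ (FdivZ_smul_vPlus_mem μ _)
  rw [eq_top_iff]
  rintro x -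
  obtain ⟨u, rfl⟩ := Submodule.Quotient.mk_surjective _ x
  have hu : u ∈ A := hA ▸ Algebra.mem_top
  rw [mk_eq_smul_vPlus]
  have h0 := FdivZ_smul_vPlus_mem (R := Kq) μ ((0 : ℕ) : ℤ)
  rw [FdivZ_natCast, Fdiv_zero, one_smul] at h0
  exact hu _ h0

/-- The operator on functions `f : ℤ → ℚ(q)` given by a shift by `s` and a weight `g`. -/
def shiftOp (g : ℤ → Kq) (s : ℤ) : Module.End Kq (ℤ → Kq) where
  toFun f r := g r * f (r + s)
  map_add' f f' := by
    funext r
    simp [mul_add]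
  map_smul' c f := by
    funext r
    simp only [Pi.smul_apply, smul_eq_mul, RingHom.id_apply]
    ring

/-- The action of the generators in the model of weight `μ`: on functions on `ℤ`,
`(E f)(r) = [r + 1] f(r + 1)`, `(F f)(r) = [μ - r + 1] f(r - 1)`, `(K f)(r) = q^(μ - 2r) f(r)`. -/
def modelGen (μ : ℕ) : Gen → Module.End Kq (ℤ → Kq)
  | .E => shiftOp (fun r => qInt (r + 1)) 1
  | .F => shiftOp (fun r => qInt (μ - r + 1)) (-1)
  | .K => shiftOp (fun r => q ^ ((μ : ℤ) - 2 * r)) 0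
  | .Ki => shiftOp (fun r => q ^ (-((μ : ℤ) - 2 * r))) 0

theorem modelGen_rel (μ : ℕ) ⦃x y : FreeU⦄ (h : URel x y) :
    FreeAlgebra.lift Kq (modelGen μ) x = FreeAlgebra.lift Kq (modelGen μ) y := by
  have hq := q_ne_zero
  cases h <;>
    simp only [map_mul, map_sub, map_one, map_smul, FreeAlgebra.lift_ι_apply, modelGen] <;>
    refine LinearMap.ext fun f => funext fun r => ?_
  · simp only [Module.End.mul_apply, shiftOp, LinearMap.coe_mk, AddHom.coe_mk, Module.End.one_apply,
      add_zero, ← mul_assoc, ← zpow_add₀ hq]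
    simp
  · simp only [Module.End.mul_apply, shiftOp, LinearMap.coe_mk, AddHom.coe_mk, Module.End.one_apply,
      add_zero, ← mul_assoc, ← zpow_add₀ hq]
    simp
  · simp only [Module.End.mul_apply, shiftOp, LinearMap.coe_mk, AddHom.coe_mk, LinearMap.sub_apply,
      LinearMap.smul_apply, Pi.sub_apply, Pi.smul_apply, smul_eq_mul, add_zero,
      add_neg_cancel_right, neg_add_cancel_right]
    have hc := qInt_commutator r μ
    have hc' : qInt (μ - 2 * r) = (q - q⁻¹)⁻¹ *
        (q ^ ((μ : ℤ) - 2 * r) - q ^ (-((μ : ℤ) - 2 * r))) := by rw [qInt, inv_mul_eq_div]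
    rw [show (μ : ℤ) - (r + 1) + 1 = μ - r by ring]
    generalize q ^ ((μ : ℤ) - 2 * r) = x at *
    generalize q ^ (-((μ : ℤ) - 2 * r)) = y at *
    linear_combination (-f r) * hc + f r * hc'
  · simp only [Module.End.mul_apply, shiftOp, LinearMap.coe_mk, AddHom.coe_mk,
      LinearMap.smul_apply, Pi.smul_apply, smul_eq_mul, add_zero]
    rw [show (μ : ℤ) - 2 * r = 2 + (μ - 2 * (r + 1)) by ring, zpow_add₀ hq]
    norm_cast
    ring
  · simp only [Module.End.mul_apply, shiftOp, LinearMap.coe_mk, AddHom.coe_mk,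
      LinearMap.smul_apply, Pi.smul_apply, smul_eq_mul, add_zero]
    rw [show (μ : ℤ) - 2 * r = -2 + (μ - 2 * (r + -1)) by ring, zpow_add₀ hq, zpow_neg]
    norm_cast
    ring

/-- A representation of `U` in which a copy of `L(μ)` sits, used to see that `L(μ)` is not too
small. -/
def model (μ : ℕ) : U →ₐ[Kq] Module.End Kq (ℤ → Kq) :=
  RingQuot.liftAlgHom Kq ⟨FreeAlgebra.lift Kq (modelGen μ), modelGen_rel μ⟩

theorem model_ofGen (μ : ℕ) (x : Gen) : model μ (ofGen x) = modelGen μ x := by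
  rw [model, ofGen, RingQuot.liftAlgHom_mkAlgHom_apply]
  exact FreeAlgebra.lift_ι_apply _ _

/-- The delta function at `r`. -/
def delta (r : ℤ) : ℤ → Kq := Pi.single r 1

theorem model_F_delta (μ : ℕ) (r : ℤ) : model μ F (delta r) = qInt (μ - r) • delta (r + 1) := by
  rw [F, model_ofGen]
  funext s
  simp only [modelGen, shiftOp, LinearMap.coe_mk, AddHom.coe_mk, Pi.smul_apply, smul_eq_mul, delta]
  rcases eq_or_ne s (r + 1) with rfl | h
  · rw [add_neg_cancel_right, Pi.single_eq_same, Pi.single_eq_same]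
    congr 2
    ring
  · rw [Pi.single_eq_of_ne h, Pi.single_eq_of_ne (by omega)]
    simp

theorem model_F_pow_delta (μ n : ℕ) :
    model μ (F ^ n) (delta 0) = (∏ i ∈ Finset.range n, qInt ((μ : ℤ) - i)) • delta n := by
  induction n with
  | zero => simp
  | succ n ih =>
    rw [pow_succ', map_mul, Module.End.mul_apply, ih, map_smul, model_F_delta, smul_smul,
      Finset.prod_range_succ]
    push_cast
    rfl

theorem model_delta_eq_zero (μ : ℕ) {u : U} (hu : u ∈ LIdeal μ) : model μ u (delta 0) = 0 := by
  induction hu using Submodule.span_induction with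
  | mem x hx =>
    rcases hx with rfl | rfl | rfl
    · rw [E, model_ofGen]
      funext s
      simp only [modelGen, shiftOp, LinearMap.coe_mk, AddHom.coe_mk, delta, Pi.zero_apply]
      rcases eq_or_ne s (-1) with rfl | h
      · rw [neg_add_cancel, qInt_zero, zero_mul]
      · rw [Pi.single_eq_of_ne (by omega), mul_zero]
    · rw [map_sub, K, model_ofGen, AlgHom.commutes]
      funext s
      simp only [modelGen, shiftOp, LinearMap.coe_mk, AddHom.coe_mk, delta, Pi.zero_apply,
        LinearMap.sub_apply, Module.algebraMap_end_apply, Pi.sub_apply, Pi.smul_apply, smul_eq_mul,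
        add_zero]
      rcases eq_or_ne s 0 with rfl | h
      · simp
      · rw [Pi.single_eq_of_ne h, mul_zero, mul_zero, sub_zero]
    · rw [model_F_pow_delta, Finset.prod_range_succ, sub_self, qInt_zero, mul_zero, zero_smul]
  | zero => rw [map_zero, LinearMap.zero_apply]
  | add x y _ _ hx hy => rw [map_add, LinearMap.add_apply, hx, hy, add_zero]
  | smul c x _ hx => rw [smul_eq_mul, map_mul, Module.End.mul_apply, hx, map_zero]

theorem linearIndependent_canL (μ : ℕ) : LinearIndependent Kq (canL μ) := by
  rw [Fintype.linearIndependent_iff]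
  intro c hc a
  have h1 : (∑ i, c i • Fdiv i) • vPlus μ = 0 := by
    rw [Finset.sum_smul, ← hc]
    exact Finset.sum_congr rfl fun i _ => smul_assoc _ _ _
  have h2 := congrFun (model_delta_eq_zero μ (smul_vPlus_eq_zero.mp h1)) a
  rw [map_sum, LinearMap.sum_apply, Finset.sum_apply, Finset.sum_eq_single a] at h2
  · rw [map_smul, LinearMap.smul_apply, Fdiv, map_smul, LinearMap.smul_apply, model_F_pow_delta,
      smul_smul, smul_smul, Pi.smul_apply, delta, Pi.single_eq_same, smul_eq_mul, mul_one,
      mul_assoc] at h2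
    refine (mul_eq_zero.mp h2).resolve_right (mul_ne_zero (inv_ne_zero (qFact_ne_zero _)) ?_)
    exact Finset.prod_ne_zero_iff.mpr fun i hi => qInt_ne_zero (by
      have := Finset.mem_range.mp hi
      have := a.2
      omega)
  · intro b _ hb
    rw [map_smul, LinearMap.smul_apply, Fdiv, map_smul, LinearMap.smul_apply, model_F_pow_delta,
      Pi.smul_apply, Pi.smul_apply, Pi.smul_apply, delta, Pi.single_eq_of_ne, smul_zero, smul_zero,
      smul_zero]
    simpa [Fin.ext_iff] using hb.symm
  · simp

/-- The canonical basis of `L(μ)`. -/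
def canBasis (μ : ℕ) : Module.Basis (Fin (μ + 1)) Kq (L μ) :=
  Module.Basis.mk (linearIndependent_canL μ) (span_canL μ).ge

theorem canBasis_apply (μ : ℕ) (a : Fin (μ + 1)) : canBasis μ a = canL μ a :=
  Module.Basis.mk_apply _ _ a

theorem canL_zero (μ : ℕ) : canL μ 0 = vPlus μ := by
  simp [canL, Fdiv_zero]

theorem vPlus_ne_zero (μ : ℕ) : vPlus μ ≠ 0 := by
  rw [← canL_zero]
  exact (linearIndependent_canL μ).ne_zero 0

/-- A nonzero combination of the vectors `F⁽ʳ⁾ w` generates the highest weight vector `w`: if the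
last nonzero coordinate is the `r`-th, then `E⁽ʳ⁾` produces a nonzero multiple of `w`. -/
theorem IsWt.exists_smul_sum_eq {M : Type*} [AddCommGroup M] [Module Kq M] [Module U M]
    [IsScalarTower Kq U M] {μ : ℕ} {w : M} (h : IsWt μ w) (hE : E • w = 0) {c : Fin (μ + 1) → Kq}
    (hc : ∃ r, c r ≠ 0) : ∃ u : U, u • ∑ r, c r • Fdiv (r : ℕ) • w = w := by
  classical
  obtain ⟨r, hr, hmax⟩ := Finset.exists_max_image (Finset.univ.filter fun r => c r ≠ 0) id
    (hc.imp fun r hr => by simpa using hr)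
  have hr0 : c r ≠ 0 := (Finset.mem_filter.mp hr).2
  have hEr : Ediv r • ∑ r, c r • Fdiv (r : ℕ) • w = (c r * vBinom q μ r) • w := by
    rw [Finset.smul_sum, Finset.sum_eq_single_of_mem r (Finset.mem_univ r)]
    · rw [smul_comm, ← FdivZ_natCast, h.Ediv_smul_FdivZ hE, smul_smul]
      simp [FdivZ, Fdiv_zero]
    · intro s _ hs
      rw [smul_comm, ← FdivZ_natCast, h.Ediv_smul_FdivZ hE]
      rcases lt_or_gt_of_ne hs with h | h
      · rw [FdivZ_of_neg (by have : (s : ℕ) < r := h; omega), zero_smul, smul_zero, smul_zero]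
      · have : c s = 0 := by
          by_contra h0
          exact absurd (hmax s (by simp [h0])) (not_le.mpr h)
        rw [this, zero_smul]
  have hB : c r * vBinom q μ r ≠ 0 := by
    refine mul_ne_zero hr0 (Finset.prod_ne_zero_iff.mpr fun i hi => div_ne_zero ?_ ?_)
    · refine qInt_ne_zero ?_
      have := Finset.mem_range.mp hi
      have := r.2
      omega
    · exact qInt_succ_ne_zero i
  refine ⟨(c r * vBinom q μ r)⁻¹ • Ediv r, ?_⟩
  rw [smul_assoc, hEr, inv_smul_smul₀ hB]

theorem isSimpleModule_L (μ : ℕ) : IsSimpleModule U (L μ) := by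
  rw [isSimpleModule_iff_toSpanSingleton_surjective]
  refine ⟨⟨⟨vPlus μ, 0, vPlus_ne_zero μ⟩⟩, fun x hx y => ?_⟩
  have hx' := (canBasis μ).sum_repr x
  simp only [canBasis_apply, canL] at hx'
  obtain ⟨u, hu⟩ := (isWt_vPlus μ).exists_smul_sum_eq (E_smul_vPlus μ)
    (c := fun r => (canBasis μ).repr x r) (by
      by_contra! h
      exact hx ((canBasis μ).ext_elem fun r => by rw [h, map_zero, Finsupp.zero_apply]))
  obtain ⟨v, rfl⟩ := Submodule.Quotient.mk_surjective _ y
  refine ⟨v * u, ?_⟩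
  rw [LinearMap.toSpanSingleton_apply, mul_smul, mk_eq_smul_vPlus, ← hx']
  exact congrArg (v • ·) hu

/-! ### `ı`-divided powers on a highest weight module of even highest weight -/

section HighestWeight

variable {M : Type*} [AddCommGroup M] [Module Kq M] [Module U M]
variable {M' : Type*} [AddCommGroup M'] [Module Kq M'] [Module U M']

/-- `w` is a highest weight vector of weight `2l` killed by `F⁽²ˡ⁺¹⁾`, and the vectors `F⁽ᵃ⁾ w`,
`0 ≤ a ≤ 2l`, form a basis of the module. So the module is a copy of `L(2l)`. -/
structure IsHighestWeight (l : ℕ) (w : M) : Prop where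
  isWt : IsWt (2 * l : ℤ) w
  E_smul : E • w = 0
  F_smul : Fdiv (2 * l + 1) • w = 0
  linearIndependent : LinearIndependent Kq (fun a : Fin (2 * l + 1) => Fdiv a • w)
  span_eq_top : Submodule.span Kq (Set.range fun a : Fin (2 * l + 1) => Fdiv a • w) = ⊤

theorem isHighestWeight_vPlus (l : ℕ) : IsHighestWeight l (vPlus (2 * l)) where
  isWt := (isWt_vPlus (2 * l)).congr (by push_cast; rfl)
  E_smul := E_smul_vPlus _
  F_smul := Fdiv_smul_vPlus_eq_zero (Nat.lt_succ_self _)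
  linearIndependent := linearIndependent_canL _
  span_eq_top := span_canL _

namespace IsHighestWeight

/-- The basis `F⁽ᵃ⁾ w`. -/
def basis {l : ℕ} {w : M} (h : IsHighestWeight l w) : Module.Basis (Fin (2 * l + 1)) Kq M :=
  Module.Basis.mk h.linearIndependent h.span_eq_top.ge

theorem basis_apply {l : ℕ} {w : M} (h : IsHighestWeight l w) (a : Fin (2 * l + 1)) :
    h.basis a = Fdiv a • w :=
  Module.Basis.mk_apply _ _ a

variable [IsScalarTower Kq U M] [IsScalarTower Kq U M']

theorem dvev_smul_eq_zero {l : ℕ} {w : M} (h : IsHighestWeight l w) {n : ℕ} (hn : 2 * l < n) :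
    dvev n • w = 0 :=
  h.isWt.dvev_smul_eq_zero h.E_smul h.F_smul hn

/-- The transition matrix from the canonical basis to the `ı`-divided powers is unitriangular, with
off-diagonal entries in `q⁻¹ ℕ[q⁻¹]`. -/
theorem exists_transition {l : ℕ} {w : M} (h : IsHighestWeight l w) :
    ∃ c : Fin (2 * l + 1) → Fin (2 * l + 1) → Kq, (∀ n r, c n r ∈ qInvN) ∧
      ∀ n : Fin (2 * l + 1), dvev n • w =
        Fdiv n • w + ∑ r ∈ Finset.univ.filter (· < n), c n r • Fdiv (r : ℕ) • w := by
  have key : ∀ n : Fin (2 * l + 1), ∃ d : ℕ → Kq, (∀ r, d r ∈ qInvN) ∧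
      dvev n • w = Fdiv n • w + ∑ r ∈ Finset.range n, d r • Fdiv r • w :=
    fun n => h.isWt.exists_dvev_smul_eq h.E_smul (by omega)
  choose d hd hsum using key
  refine ⟨fun n r => d n r, fun n r => hd n r, fun n => ?_⟩
  rw [hsum, add_right_inj]
  refine (Finset.sum_nbij (fun r : Fin (2 * l + 1) => (r : ℕ)) ?_ ?_ ?_ ?_).symm
  · exact fun r hr => Finset.mem_range.mpr (Finset.mem_filter.mp hr).2
  · exact fun r _ s _ hrs => Fin.ext hrs
  · intro r hr
    have hr' : r < n := Finset.mem_range.mp (Finset.mem_coe.mp hr)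
    exact ⟨⟨r, hr'.trans n.2⟩,
      Finset.mem_coe.mpr (Finset.mem_filter.mpr ⟨Finset.mem_univ _, hr'⟩), rfl⟩
  · exact fun _ _ => rfl

/-- The coordinates of the `ı`-divided powers in the canonical basis: a unitriangular matrix over
`q⁻¹ ℤ[q⁻¹]`. -/
theorem repr_dvev {l : ℕ} {w : M} (h : IsHighestWeight l w) (n : Fin (2 * l + 1)) :
    h.basis.repr (dvev n • w) n = 1 ∧ (∀ r, n < r → h.basis.repr (dvev n • w) r = 0) ∧
      ∀ r, r < n → h.basis.repr (dvev n • w) r ∈ qInvZ := by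
  obtain ⟨c, hc, hsum⟩ := h.exists_transition
  have hrepr : ∀ r, h.basis.repr (dvev n • w) r =
      (if r = n then 1 else 0) + if r < n then c n r else 0 := by
    intro r
    rw [hsum]
    simp only [← h.basis_apply, map_add, map_sum, map_smul, Module.Basis.repr_self,
      Finsupp.add_apply, Finsupp.finsetSum_apply, Finsupp.smul_apply, Finsupp.single_apply,
      smul_eq_mul, mul_ite, mul_one, mul_zero, Finset.sum_ite_eq', Finset.mem_filter,
      Finset.mem_univ, true_and, eq_comm (a := n)]
  refine ⟨by simp [hrepr], fun r hr => ?_, fun r hr => ?_⟩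
  · rw [hrepr, if_neg hr.ne', if_neg hr.not_gt, add_zero]
  · rw [hrepr, if_neg hr.ne, if_pos hr, zero_add]
    exact qInvN_subset_qInvZ (hc n r)

theorem dvev_isBasis {l : ℕ} {w : M} (h : IsHighestWeight l w) :
    LinearIndependent Kq (fun n : Fin (2 * l + 1) => dvev n • w) ∧
      Submodule.span Kq (Set.range fun n : Fin (2 * l + 1) => dvev n • w) = ⊤ := by
  rw [h.basis.is_basis_iff_det, Module.Basis.det_apply, Matrix.det_of_isUpperTriangular]
  · rw [Finset.prod_eq_one]
    · exact isUnit_one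
    · intro n _
      exact (h.repr_dvev n).1
  · intro r n hrn
    exact (h.repr_dvev n).2.1 r hrn

/-- The basis `𝔱⁽ⁿ⁾_ev w`. -/
def dvBasis {l : ℕ} {w : M} (h : IsHighestWeight l w) : Module.Basis (Fin (2 * l + 1)) Kq M :=
  Module.Basis.mk h.dvev_isBasis.1 h.dvev_isBasis.2.ge

theorem dvBasis_apply {l : ℕ} {w : M} (h : IsHighestWeight l w) (n : Fin (2 * l + 1)) :
    h.dvBasis n = dvev n • w :=
  Module.Basis.mk_apply _ _ n

/-- The last nonzero coordinate of a vector is the same for the two bases. -/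
theorem repr_eq_dvBasis_repr {l : ℕ} {w : M} (h : IsHighestWeight l w) (x : M)
    (r : Fin (2 * l + 1)) : h.basis.repr x r = h.dvBasis.repr x r +
      ∑ n ∈ Finset.univ.filter (r < ·), h.dvBasis.repr x n * h.basis.repr (dvev n • w) r := by
  conv_lhs => rw [← h.dvBasis.sum_repr x]
  simp only [map_sum, map_smul, Finsupp.finsetSum_apply, Finsupp.smul_apply, smul_eq_mul,
    h.dvBasis_apply]
  rw [← Finset.sum_filter_add_sum_filter_not _ (r < ·), add_comm, add_left_inj,
    Finset.sum_eq_single_of_mem r (by simp), (h.repr_dvev r).1, mul_one]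
  intro n hn hnr
  have : n < r := lt_of_le_of_ne (by simpa using hn) hnr
  rw [(h.repr_dvev n).2.1 r this, mul_zero]

/-- A vector with coordinates in `q⁻¹ ℤ[q⁻¹]` whose coordinates in the basis of `ı`-divided powers
are bar invariant is zero. -/
theorem eq_zero_of_bar {l : ℕ} {w : M} (h : IsHighestWeight l w) {x : M}
    (hZ : ∀ r, h.basis.repr x r ∈ qInvZ) (hb : ∀ n, bar (h.dvBasis.repr x n) = h.dvBasis.repr x n) :
    x = 0 := by
  refine h.dvBasis.ext_elem fun r => ?_
  rw [map_zero, Finsupp.zero_apply]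
  induction r using WellFoundedGT.induction with
  | ind r ih =>
    have hr := h.repr_eq_dvBasis_repr x r
    rw [Finset.sum_eq_zero fun n hn => by rw [ih n (by simpa using hn), zero_mul], add_zero] at hr
    exact eq_zero_of_mem_qInvZ_of_bar (hr ▸ hZ r) (hb r)

theorem dvBasis_repr_mem_Aq {l : ℕ} {w : M} (h : IsHighestWeight l w) {x : M}
    (hA : ∀ r, h.basis.repr x r ∈ Aq) (n : Fin (2 * l + 1)) : h.dvBasis.repr x n ∈ Aq := by
  induction n using WellFoundedGT.induction with
  | ind r ih =>
    rw [← sub_eq_iff_eq_add.mpr (h.repr_eq_dvBasis_repr x r)]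
    refine sub_mem (hA r) (sum_mem fun n hn => mul_mem (ih n (by simpa using hn)) ?_)
    exact qInvZ_subset_Aq ((h.repr_dvev n).2.2 r (by simpa using hn))

/-- A semilinear map which fixes quantum integers and matches the `ı`-divided powers commutes with
`𝔱`, since the recursion for the `ı`-divided powers has quantum integers as coefficients. -/
theorem map_t_smul {l : ℕ} {w : M} (h : IsHighestWeight l w) {w' : M'} {σ : Kq →+* Kq}
    (hσ : ∀ m, σ (qInt m) = qInt m) {f : M →ₛₗ[σ] M'}
    (hf : ∀ n, f (dvev n • w) = dvev n • w') (x : M) : f (t • x) = t • f x := by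
  have hE : f.comp (Algebra.lsmul Kq Kq M t) = (Algebra.lsmul Kq Kq M' t).comp f := by
    refine h.dvBasis.ext fun n => ?_
    simp only [LinearMap.comp_apply, Algebra.lsmul_coe, h.dvBasis_apply]
    obtain ⟨m, hm | hm⟩ := (n : ℕ).even_or_odd'
    · rw [hm, hf, t_smul_dvev_even, t_smul_dvev_even, map_add, LinearMap.map_smulₛₗ,
        LinearMap.map_smulₛₗ, hσ, hσ, hf, hf]
    · rw [hm, hf, t_smul_dvev_odd, t_smul_dvev_odd, LinearMap.map_smulₛₗ, hσ, hf]
  simpa using LinearMap.congr_fun hE x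

end IsHighestWeight

theorem map_dvev_smul [IsScalarTower Kq U M] [IsScalarTower Kq U M'] {w : M} {w' : M'}
    {σ : Kq →+* Kq} (hσ : ∀ m, σ (qInt m) = qInt m) {f : M →ₛₗ[σ] M'} (hw : f w = w')
    (ht : ∀ x, f (t • x) = t • f x) (n : ℕ) : f (dvev n • w) = dvev n • w' := by
  induction n using dvev_induction with
  | h0 => rw [dvev_zero, one_smul, one_smul, hw]
  | hodd m h1 h2 =>
    have h0 : qInt (2 * m + 1) ≠ 0 := qInt_ne_zero (by omega)
    have hT := congrArg f (t_smul_dvev_even m w)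
    rw [ht, h1, t_smul_dvev_even, map_add, LinearMap.map_smulₛₗ, LinearMap.map_smulₛₗ, hσ,
      hσ] at hT
    have h3 : qInt (2 * m) • f (dvev (2 * m - 1) • w) = qInt (2 * m) • dvev (2 * m - 1) • w' := by
      rcases h2 with rfl | h2
      · simp [qInt_zero]
      · rw [h2]
    rw [h3, add_left_inj] at hT
    exact (smul_right_injective M' h0 hT).symm
  | heven m h1 =>
    have h0 : qInt (2 * m + 2) ≠ 0 := qInt_ne_zero (by omega)
    have hT := congrArg f (t_smul_dvev_odd m w)
    rw [ht, h1, t_smul_dvev_odd, LinearMap.map_smulₛₗ, hσ] at hT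
    exact (smul_right_injective M' h0 hT).symm

namespace IsHighestWeight

variable [IsScalarTower Kq U M] [IsScalarTower Kq U M']

theorem bar_iff {l : ℕ} {w : M} (h : IsHighestWeight l w) (ψ : M →ₛₗ[bar] M) :
    (ψ w = w ∧ ∀ x, ψ (t • x) = t • ψ x) ↔ ∀ n, ψ (dvev n • w) = dvev n • w := by
  refine ⟨fun hψ => map_dvev_smul bar_qInt hψ.1 hψ.2, fun hψ => ⟨?_, h.map_t_smul bar_qInt hψ⟩⟩
  simpa [dvev_zero] using hψ 0

/-- The antilinear map fixing the `ı`-divided powers applied to `w`. -/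
def barMap {l : ℕ} {w : M} (h : IsHighestWeight l w) : M →ₛₗ[bar] M where
  toFun x := ∑ n, bar (h.dvBasis.repr x n) • h.dvBasis n
  map_add' x y := by simp [add_smul, Finset.sum_add_distrib]
  map_smul' c x := by simp [mul_smul, Finset.smul_sum]

theorem barMap_dvev {l : ℕ} {w : M} (h : IsHighestWeight l w) (n : ℕ) :
    h.barMap (dvev n • w) = dvev n • w := by
  rcases lt_or_ge (2 * l) n with hn | hn
  · rw [h.dvev_smul_eq_zero hn, map_zero]
  · have e : dvev n • w = h.dvBasis ⟨n, by omega⟩ :=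
      (h.dvBasis_apply ⟨n, by omega⟩).symm
    rw [e]
    simp [barMap, Finsupp.single_apply, apply_ite bar]

theorem bar_repr {l : ℕ} {w : M} (h : IsHighestWeight l w) {ψ : M →ₛₗ[bar] M}
    (hψ : ∀ n, ψ (dvev n • w) = dvev n • w) {x : M} (hx : ψ x = x) (n : Fin (2 * l + 1)) :
    bar (h.dvBasis.repr x n) = h.dvBasis.repr x n := by
  have e : ψ = h.barMap := h.dvBasis.ext fun n => by rw [h.dvBasis_apply, hψ, h.barMap_dvev]
  rw [e] at hx
  have h1 : h.dvBasis.repr (∑ n, bar (h.dvBasis.repr x n) • h.dvBasis n) n =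
    bar (h.dvBasis.repr x n) := by simp [Finsupp.single_apply]
  rw [← h1]
  exact congrArg (fun y => h.dvBasis.repr y n) hx

theorem existsUnique_bar {l : ℕ} {w : M} (h : IsHighestWeight l w) :
    ∃! ψ : M →ₛₗ[bar] M, ψ w = w ∧ ∀ x, ψ (t • x) = t • ψ x := by
  refine ⟨h.barMap, (h.bar_iff _).mpr h.barMap_dvev, fun ψ hψ => h.dvBasis.ext fun n => ?_⟩
  rw [h.dvBasis_apply, h.barMap_dvev, (h.bar_iff ψ).mp hψ]

/-- A bar-invariant vector which agrees with `F⁽ⁿ⁾ w` modulo `q⁻¹ ℤ[q⁻¹]`-combinations of the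
canonical basis is `𝔱⁽ⁿ⁾_ev w`. -/
theorem eq_dvev_smul {l : ℕ} {w : M} (h : IsHighestWeight l w) {n : Fin (2 * l + 1)} {x : M}
    {ψ : M →ₛₗ[bar] M} (hψ : ψ w = w ∧ ∀ x, ψ (t • x) = t • ψ x) (hx : ψ x = x)
    {c : Fin (2 * l + 1) → Kq} (hc : ∀ r, c r ∈ qInvZ)
    (hxc : x = Fdiv n • w + ∑ r, c r • Fdiv (r : ℕ) • w) : x = dvev n • w := by
  rw [h.bar_iff] at hψ
  rw [← sub_eq_zero]
  refine h.eq_zero_of_bar (fun r => ?_) (h.bar_repr hψ (by rw [map_sub, hx, hψ]))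
  obtain ⟨d, hd, hsum⟩ := h.exists_transition
  have e : h.basis.repr (x - dvev n • w) r = c r - if r < n then d n r else 0 := by
    rw [hxc, hsum, add_sub_add_left_eq_sub]
    simp [← h.basis_apply, Finsupp.single_apply]
  rw [e]
  refine sub_mem_qInvZ (hc r) ?_
  split_ifs
  exacts [qInvN_subset_qInvZ (hd n r), qInvN_subset_qInvZ zero_mem_qInvN]

end IsHighestWeight
end HighestWeight

theorem exists_aeval_tI (x : Ui) : ∃ p : Kq[X], aeval tI p = x := by
  have hx : (x : U) ∈ Algebra.adjoin Kq {t} := x.2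
  rw [Algebra.adjoin_singleton_eq_range_aeval] at hx
  obtain ⟨p, hp⟩ := hx
  refine ⟨p, Subtype.ext ?_⟩
  have : ((aeval tI p : Ui) : U) = aeval ((tI : Ui) : U) p :=
    (aeval_algHom_apply Ui.val tI p).symm
  rw [this]
  exact hp

section HighestWeight

variable {M : Type*} [AddCommGroup M] [Module Kq M] [Module U M] [IsScalarTower Kq U M]
variable {M' : Type*} [AddCommGroup M'] [Module Kq M'] [Module U M'] [IsScalarTower Kq U M']

theorem map_Ui_smul {f : M →ₗ[Kq] M'} (hf : ∀ x, f (t • x) = t • f x) (u : Ui) (x : M) :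
    f (u • x) = u • f x := by
  obtain ⟨p, rfl⟩ := exists_aeval_tI u
  have hf' : ∀ x, f (tI • x) = tI • f x := hf
  induction p using Polynomial.induction_on' generalizing x with
  | add p r hp hr => rw [map_add, add_smul, map_add, hp, hr, add_smul]
  | monomial n c =>
    rw [aeval_monomial, mul_smul, mul_smul, algebraMap_smul, algebraMap_smul, map_smul]
    congr 1
    induction n with
    | zero => simp
    | succ n ih => rw [pow_succ', mul_smul, mul_smul, hf', ih]

/-- A highest weight module of highest weight `2l'` maps onto those of highest weight `2l ≤ 2l'`
as a `Uⁱ`-module. -/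
theorem IsHighestWeight.exists_map {l l' : ℕ} (hl : l ≤ l') {w : M} (h : IsHighestWeight l' w)
    {w' : M'} (h' : IsHighestWeight l w') : ∃ π : M →ₗ[Ui] M', π w = w' := by
  let f : M →ₗ[Kq] M' := h.dvBasis.constr Kq fun n => dvev n • w'
  have hf : ∀ n, f (dvev n • w) = dvev n • w' := by
    intro n
    rcases lt_or_ge (2 * l') n with hn | hn
    · rw [h.dvev_smul_eq_zero hn, h'.dvev_smul_eq_zero (by omega), map_zero]
    · have e := h.dvBasis.constr_basis Kq (fun n => dvev n • w') ⟨n, by omega⟩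
      rwa [h.dvBasis_apply] at e
  have hU := map_Ui_smul (h.map_t_smul (fun _ => rfl) hf)
  refine ⟨{ toFun := f, map_add' := f.map_add, map_smul' := hU }, ?_⟩
  simpa [dvev_zero] using hf 0

end HighestWeight

/-! ### The `ı`-canonical basis of `L(2l)` -/

theorem isIBar_iff {μ : ℕ} {ψ : L μ →ₛₗ[bar] L μ} :
    IsIBar μ ψ ↔ ψ (vPlus μ) = vPlus μ ∧ ∀ x, ψ (t • x) = t • ψ x :=
  ⟨fun h => ⟨h.fix_v, h.comm_t⟩, fun h => ⟨h.1, h.2⟩⟩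

theorem existsUnique_isIBar (l : ℕ) : ∃! ψ : L (2 * l) →ₛₗ[bar] L (2 * l), IsIBar (2 * l) ψ := by
  simp only [isIBar_iff]
  exact (isHighestWeight_vPlus l).existsUnique_bar

theorem isIBar_iff_dvev (l : ℕ) (ψ : L (2 * l) →ₛₗ[bar] L (2 * l)) : IsIBar (2 * l) ψ ↔
    ∀ n : ℕ, ψ (dvev n • vPlus (2 * l)) = dvev n • vPlus (2 * l) := by
  rw [isIBar_iff]
  exact (isHighestWeight_vPlus l).bar_iff ψ

theorem exists_transition_L (l : ℕ) : ∃ c : Fin (2 * l + 1) → Fin (2 * l + 1) → Kq,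
    (∀ n r : Fin (2 * l + 1), c n r ∈ qInvN) ∧
      ∀ n : Fin (2 * l + 1), dvev n • vPlus (2 * l) =
        canL (2 * l) n + ∑ r ∈ Finset.univ.filter (· < n), c n r • canL (2 * l) r :=
  (isHighestWeight_vPlus l).exists_transition

theorem isICanonicalElement_dvev (l : ℕ) (n : Fin (2 * l + 1)) :
    IsICanonicalElement (2 * l) n (dvev n • vPlus (2 * l)) where
  invariant := by
    obtain ⟨ψ, hψ, -⟩ := existsUnique_isIBar l
    exact ⟨ψ, hψ, (isIBar_iff_dvev l ψ).mp hψ n⟩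
  lattice := by
    obtain ⟨c, hc, hsum⟩ := exists_transition_L l
    refine ⟨fun r => if r < n then c n r else 0, fun r => ?_, ?_⟩
    · beta_reduce
      split_ifs
      exacts [qInvN_subset_qInvZ (hc n r), qInvN_subset_qInvZ zero_mem_qInvN]
    · rw [hsum, Finset.sum_filter]
      refine congrArg _ (Finset.sum_congr rfl fun r _ => ?_)
      beta_reduce
      split_ifs
      · rfl
      · exact (zero_smul Kq (canL (2 * l) r)).symm

theorem IsICanonicalElement.eq_dvev {l : ℕ} {n : Fin (2 * l + 1)} {x : L (2 * l)}
    (h : IsICanonicalElement (2 * l) n x) : x = dvev n • vPlus (2 * l) := by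
  obtain ⟨ψ, hψ, hx⟩ := h.invariant
  obtain ⟨c, hc, hxc⟩ := h.lattice
  exact (isHighestWeight_vPlus l).eq_dvev_smul (isIBar_iff.mp hψ) hx hc hxc

/-! ### The coideal subalgebra as a polynomial ring in `𝔱` -/

theorem span_evPoly : Submodule.span Kq (Set.range evPoly) = ⊤ := by
  set S := Submodule.span Kq (Set.range evPoly) with hS
  have hmem : ∀ n, evPoly n ∈ S := fun n => Submodule.subset_span ⟨n, rfl⟩
  have hX : ∀ p ∈ S, X * p ∈ S := by
    intro p hp
    induction hp using Submodule.span_induction with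
    | mem p hp =>
      obtain ⟨n, rfl⟩ := hp
      obtain ⟨m, rfl | rfl⟩ := n.even_or_odd'
      · rw [X_mul_evPoly_even, ← smul_eq_C_mul, ← smul_eq_C_mul]
        exact S.add_mem (S.smul_mem _ (hmem _)) (S.smul_mem _ (hmem _))
      · rw [X_mul_evPoly_odd, ← smul_eq_C_mul]
        exact S.smul_mem _ (hmem _)
    | zero => rw [mul_zero]; exact S.zero_mem
    | add p r _ _ hp hr => rw [mul_add]; exact S.add_mem hp hr
    | smul c p _ hp => rw [mul_smul_comm]; exact S.smul_mem c hp
  have hpow : ∀ n : ℕ, (X : Kq[X]) ^ n ∈ S := by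
    intro n
    induction n with
    | zero => rw [pow_zero, ← evPoly_zero]; exact hmem 0
    | succ n ih => rw [pow_succ']; exact hX _ ih
  rw [eq_top_iff]
  intro p hp
  clear hp
  induction p using Polynomial.induction_on' with
  | add p r hp hr => exact S.add_mem hp hr
  | monomial n c =>
    rw [← C_mul_X_pow_eq_monomial, ← smul_eq_C_mul]
    exact S.smul_mem c (hpow n)

theorem exists_eq_sum_evPoly (p : Kq[X]) : ∃ c : ℕ →₀ Kq, (c.sum fun n a => a • evPoly n) = p :=
  Finsupp.mem_span_range_iff_exists_finsupp.mp (span_evPoly ▸ Submodule.mem_top)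

theorem aeval_sum_evPoly (c : ℕ →₀ Kq) :
    aeval tI (c.sum fun n a => a • evPoly n) = c.sum fun n a => a • dvev n := by
  rw [map_finsuppSum]
  simp only [map_smul, dvev]

theorem exists_eq_sum_dvev (x : Ui) : ∃ c : ℕ →₀ Kq, (c.sum fun n a => a • dvev n) = x := by
  obtain ⟨p, rfl⟩ := exists_aeval_tI x
  obtain ⟨c, rfl⟩ := exists_eq_sum_evPoly p
  exact ⟨c, (aeval_sum_evPoly c).symm⟩

/-- The coefficients of an element of `Uⁱ` in the `ı`-divided powers are the coordinates of its
value on a highest weight vector of large weight. -/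
theorem IsHighestWeight.dvBasis_repr_sum_smul {M : Type*} [AddCommGroup M] [Module Kq M]
    [Module U M] [IsScalarTower Kq U M] {l : ℕ} {w : M} (h : IsHighestWeight l w) (c : ℕ →₀ Kq)
    (n : Fin (2 * l + 1)) :
    h.dvBasis.repr ((c.sum fun i a => a • dvev i) • w) n = c n := by
  have hr : ∀ i : ℕ, h.dvBasis.repr (dvev i • w) n = if i = n then 1 else 0 := by
    intro i
    rcases lt_or_ge (2 * l) i with hi | hi
    · rw [h.dvev_smul_eq_zero hi, map_zero, Finsupp.zero_apply, if_neg (by omega)]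
    · have e := h.dvBasis_apply ⟨i, by omega⟩
      dsimp only at e
      rw [← e, Module.Basis.repr_self, Finsupp.single_apply]
      simp [Fin.ext_iff]
  rw [Finsupp.sum, Finset.sum_smul, map_sum, Finsupp.finsetSum_apply]
  simp only [smul_assoc, map_smul, Finsupp.smul_apply, hr, smul_eq_mul, mul_ite, mul_one, mul_zero,
    Finset.sum_ite_eq', Finsupp.mem_support_iff]
  split_ifs with h0
  · rfl
  · exact (Finsupp.notMem_support_iff.mp h0).symm

theorem eq_zero_of_smul_vPlus {x : Ui} (l₀ : ℕ) (hx : ∀ l ≥ l₀, x • vPlus (2 * l) = 0) : x = 0 := by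
  obtain ⟨c, rfl⟩ := exists_eq_sum_dvev x
  have hc : c = 0 := by
    ext n
    have h := (isHighestWeight_vPlus (l₀ + n)).dvBasis_repr_sum_smul c ⟨n, by omega⟩
    rw [hx _ (by omega), map_zero] at h
    exact h.symm
  rw [hc, Finsupp.sum_zero_index]

theorem sum_dvev_injective {c c' : ℕ →₀ Kq}
    (h : (c.sum fun n a => a • dvev n) = c'.sum fun n a => a • dvev n) : c = c' := by
  ext n
  have hw := isHighestWeight_vPlus n
  rw [← show _ = c n from hw.dvBasis_repr_sum_smul c ⟨n, by omega⟩, h]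
  exact hw.dvBasis_repr_sum_smul c' ⟨n, by omega⟩

theorem linearIndependent_dvev : LinearIndependent Kq dvev :=
  fun _ _ h => sum_dvev_injective h

theorem span_dvev : Submodule.span Kq (Set.range dvev) = ⊤ := by
  rw [eq_top_iff]
  rintro x -
  exact Finsupp.mem_span_range_iff_exists_finsupp.mpr (exists_eq_sum_dvev x)

theorem aeval_tI_bijective : Function.Bijective (aeval tI : Kq[X] →ₐ[Kq] Ui) := by
  refine ⟨fun p p' hp => ?_, exists_aeval_tI⟩
  obtain ⟨c, rfl⟩ := exists_eq_sum_evPoly p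
  obtain ⟨c', rfl⟩ := exists_eq_sum_evPoly p'
  rw [aeval_sum_evPoly, aeval_sum_evPoly] at hp
  rw [sum_dvev_injective hp]

/-- `Uⁱ` is the polynomial ring in `𝔱`. -/
def polyEquiv : Kq[X] ≃ₐ[Kq] Ui := AlgEquiv.ofBijective (aeval tI) aeval_tI_bijective

/-- The bar involution of `Uⁱ`. -/
def barUi : Ui →+* Ui :=
  (polyEquiv : Kq[X] →+* Ui).comp ((mapRingHom bar).comp (polyEquiv.symm : Ui →+* Kq[X]))

theorem barUi_aeval (p : Kq[X]) : barUi (aeval tI p) = aeval tI (p.map bar) := by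
  have h : polyEquiv.symm (aeval tI p) = p := polyEquiv.symm_apply_apply p
  simp only [barUi, RingHom.comp_apply, RingHom.coe_coe, h, coe_mapRingHom]
  rfl

theorem isIBarAlg_barUi : IsIBarAlg barUi where
  antilinear c x := by
    obtain ⟨p, rfl⟩ := exists_aeval_tI x
    rw [← map_smul, barUi_aeval, barUi_aeval, ← map_smul, smul_eq_C_mul, smul_eq_C_mul,
      Polynomial.map_mul, map_C]
  fix_t := by
    have := barUi_aeval X
    rwa [map_X, aeval_X] at this

theorem IsIBarAlg.eq_barUi {φ : Ui →+* Ui} (h : IsIBarAlg φ) : φ = barUi := by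
  ext1 x
  obtain ⟨p, rfl⟩ := exists_aeval_tI x
  rw [barUi_aeval]
  induction p using Polynomial.induction_on' with
  | add p r hp hr => rw [map_add, map_add, hp, hr, Polynomial.map_add, map_add]
  | monomial n c =>
    rw [← C_mul_X_pow_eq_monomial, ← smul_eq_C_mul, map_smul, h.antilinear, map_pow, aeval_X,
      map_pow, h.fix_t, smul_eq_C_mul]
    simp [Algebra.smul_def]

theorem barUi_dvev (n : ℕ) : barUi (dvev n) = dvev n := by
  rw [dvev, barUi_aeval, map_bar_evPoly]

/-! ### Integral forms -/

theorem Ediv_mem_UA (n : ℕ) : Ediv n ∈ UA := Algebra.subset_adjoin (Or.inl ⟨n, rfl⟩)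

theorem Fdiv_mem_UA (n : ℕ) : Fdiv n ∈ UA := Algebra.subset_adjoin (Or.inr ⟨n, rfl⟩)

theorem FdivZ_mem_UA (a : ℤ) : FdivZ a ∈ UA := by
  rw [FdivZ]
  split_ifs
  exacts [zero_mem _, Fdiv_mem_UA _]

/-- A span over `𝒜` of vectors which the divided powers map into that span is stable under `UA`. -/
theorem UA_smul_mem_span {M : Type*} [AddCommGroup M] [Module Aq M] [Module U M]
    [IsScalarTower Aq U M] {s : Set M}
    (hE : ∀ n, ∀ z ∈ s, Ediv n • z ∈ Submodule.span Aq s)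
    (hF : ∀ n, ∀ z ∈ s, Fdiv n • z ∈ Submodule.span Aq s) {u : U} (hu : u ∈ UA) {z : M}
    (hz : z ∈ Submodule.span Aq s) : u • z ∈ Submodule.span Aq s := by
  have key : ∀ u : U, (∀ z ∈ s, u • z ∈ Submodule.span Aq s) →
      ∀ z ∈ Submodule.span Aq s, u • z ∈ Submodule.span Aq s := by
    intro u hu z hz
    induction hz using Submodule.span_induction with
    | mem z hz => exact hu z hz
    | zero => rw [smul_zero]; exact Submodule.zero_mem _
    | add x y _ _ hx hy => rw [smul_add]; exact Submodule.add_mem _ hx hy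
    | smul c x _ hx => rw [smul_comm]; exact Submodule.smul_mem _ c hx
  induction hu using Algebra.adjoin_induction generalizing z with
  | mem u hu =>
    rcases hu with ⟨n, rfl⟩ | ⟨n, rfl⟩
    exacts [key _ (hE n) z hz, key _ (hF n) z hz]
  | algebraMap c => rw [algebraMap_smul]; exact Submodule.smul_mem _ c hz
  | add u v _ _ hu hv => rw [add_smul]; exact Submodule.add_mem _ (hu hz) (hv hz)
  | mul u v _ _ hu hv => rw [mul_smul]; exact hu (hv hz)

theorem UA_smul_mem_dotUA {k : ℤ} {u : U} (hu : u ∈ UA) {y : dotU k} (hy : y ∈ dotUA k) :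
    u • y ∈ dotUA k := by
  refine UA_smul_mem_span (fun n z hz => ?_) (fun n z hz => ?_) hu hy <;>
    obtain ⟨v, hv, rfl⟩ := hz
  · exact Submodule.subset_span ⟨_, mul_mem (Ediv_mem_UA n) hv, smul_smul _ _ _⟩
  · exact Submodule.subset_span ⟨_, mul_mem (Fdiv_mem_UA n) hv, smul_smul _ _ _⟩

theorem dotOne_mem_dotUA (k : ℤ) : dotOne k ∈ dotUA k :=
  Submodule.subset_span ⟨1, one_mem _, (one_smul _ _).symm⟩

theorem isWt_dotOne (k : ℤ) : IsWt k (dotOne k) := by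
  have h : (K - algebraMap Kq U (q ^ k)) • dotOne k = 0 := by
    rw [dotOne, ← Submodule.Quotient.mk_smul, smul_eq_mul, mul_one, Submodule.Quotient.mk_eq_zero]
    exact Submodule.subset_span rfl
  rwa [sub_smul, algebraMap_smul, sub_eq_zero] at h

/-- The `𝒜`-form of `U̇ 1_{2k}` is spanned by weight vectors of even weight. -/
theorem dotUA_le_span_isWt (k : ℤ) : dotUA (2 * k) ≤
    Submodule.span Aq {z | z ∈ dotUA (2 * k) ∧ ∃ j : ℤ, IsWt (2 * j) z} := by
  refine Submodule.span_le.mpr ?_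
  rintro _ ⟨u, hu, rfl⟩
  refine UA_smul_mem_span ?_ ?_ hu
    (Submodule.subset_span ⟨dotOne_mem_dotUA _, k, isWt_dotOne _⟩)
  · rintro n z ⟨hz, j, hj⟩
    exact Submodule.subset_span ⟨UA_smul_mem_dotUA (Ediv_mem_UA n) hz, j + n,
      (hj.Ediv_smul n).congr (by ring)⟩
  · rintro n z ⟨hz, j, hj⟩
    exact Submodule.subset_span ⟨UA_smul_mem_dotUA (Fdiv_mem_UA n) hz, j - n,
      (hj.Fdiv_smul n).congr (by ring)⟩

/-- The `ı`-divided powers preserve the `𝒜`-form, since the coefficients of their PBW expansion on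
weight vectors lie in `𝒜`. -/
theorem dvev_mem_UiA (n : ℕ) : dvev n ∈ UiA := by
  intro k y hy
  have hy' := dotUA_le_span_isWt k hy
  clear hy
  induction hy' using Submodule.span_induction with
  | mem z hz =>
    obtain ⟨hz, j, hj⟩ := hz
    rw [hj.dvev_smul (Nat.lt_succ_self n)]
    refine Submodule.sum_mem _ fun c _ => Submodule.sum_mem _ fun b _ => ?_
    exact Submodule.smul_mem _ (⟨_, pbwCoef_mem_Aq j n b c⟩ : Aq)
      (UA_smul_mem_dotUA (FdivZ_mem_UA _) (UA_smul_mem_dotUA (Ediv_mem_UA b) hz))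
  | zero => rw [smul_zero]; exact Submodule.zero_mem _
  | add x y _ _ hx hy => rw [smul_add]; exact Submodule.add_mem _ hx hy
  | smul c x _ hx => rw [smul_comm]; exact Submodule.smul_mem _ c hx

/-- The canonical map `U̇ 1_{2l} → L(2l)`. -/
def dotToL (l : ℕ) : dotU (2 * l) →ₗ[U] L (2 * l) :=
  Submodule.factor (Submodule.span_mono (by
    rw [Set.singleton_subset_iff, show (2 * (l : ℤ)) = ((2 * l : ℕ) : ℤ) by push_cast; rfl,
      zpow_natCast]
    simp))

theorem dotToL_dotOne (l : ℕ) : dotToL l (dotOne (2 * l)) = vPlus (2 * l) := rfl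

theorem UA_smul_vPlus_mem (l : ℕ) {u : U} (hu : u ∈ UA) :
    u • vPlus l ∈ Submodule.span Aq (Set.range (canL l)) := by
  refine UA_smul_mem_span ?_ ?_ hu ?_
  · rintro n _ ⟨a, rfl⟩
    rw [canL_eq_FdivZ, (isWt_vPlus l).Ediv_smul_FdivZ (E_smul_vPlus l)]
    exact Submodule.smul_mem _ (⟨_, vBinom_q_mem_Aq _ _⟩ : Aq) (FdivZ_smul_vPlus_mem l _)
  · rintro n _ ⟨a, rfl⟩
    rw [canL_eq_FdivZ, Fdiv_smul_FdivZ]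
    exact Submodule.smul_mem _ (⟨_, vBinom_q_mem_Aq _ _⟩ : Aq) (FdivZ_smul_vPlus_mem l _)
  · have h := FdivZ_smul_vPlus_mem (R := Aq) l ((0 : ℕ) : ℤ)
    rwa [FdivZ_natCast, Fdiv_zero, one_smul] at h

theorem dotToL_mem (l : ℕ) {y : dotU (2 * l)} (hy : y ∈ dotUA (2 * l)) :
    dotToL l y ∈ Submodule.span Aq (Set.range (canL (2 * l))) := by
  induction hy using Submodule.span_induction with
  | mem y hy =>
    obtain ⟨u, hu, rfl⟩ := hy
    rw [map_smul, dotToL_dotOne]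
    exact UA_smul_vPlus_mem _ hu
  | zero => rw [map_zero]; exact Submodule.zero_mem _
  | add x y _ _ hx hy => rw [map_add]; exact Submodule.add_mem _ hx hy
  | smul c x _ hx =>
    rw [LinearMap.map_smul_of_tower]
    exact Submodule.smul_mem _ c hx

/-- The coordinates of an element of the integral form in the `ı`-divided powers lie in `𝒜`: they
can be read off on `L(2l)` for large `l`, whose transition matrix is unitriangular over `𝒜`. -/
theorem coeff_mem_Aq {c : ℕ →₀ Kq} (hc : (c.sum fun n a => a • dvev n) ∈ UiA) (n : ℕ) :
    c n ∈ Aq := by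
  have h1 : (c.sum fun n a => a • dvev n) • vPlus (2 * n) ∈
      Submodule.span Aq (Set.range (canL (2 * n))) :=
    dotToL_mem n (hc n _ (dotOne_mem_dotUA (2 * n)))
  have h := isHighestWeight_vPlus n
  have h2 := h.dvBasis_repr_sum_smul c ⟨n, by omega⟩
  rw [← show _ = c n from h2]
  obtain ⟨a, ha⟩ := (Submodule.mem_span_range_iff_exists_fun Aq).mp h1
  refine h.dvBasis_repr_mem_Aq (fun r => ?_) _
  rw [← ha]
  have e : h.basis.repr (∑ i, a i • canL (2 * n) i) r = a r := by
    have e1 : ∑ i, a i • canL (2 * n) i = ∑ i, (a i : Kq) • h.basis i :=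
      Finset.sum_congr rfl fun i _ => by rw [h.basis_apply]; rfl
    rw [e1]
    simp [Finsupp.single_apply]
  rw [e]
  exact (a r).2

theorem span_Aq_dvev : Submodule.span Aq (Set.range dvev) = UiA := by
  refine le_antisymm (Submodule.span_le.mpr ?_) fun x hx => ?_
  · rintro _ ⟨n, rfl⟩
    exact dvev_mem_UiA n
  · obtain ⟨c, rfl⟩ := exists_eq_sum_dvev x
    refine Submodule.sum_mem _ fun n _ => ?_
    exact Submodule.smul_mem _ (⟨c n, coeff_mem_Aq hx n⟩ : Aq) (Submodule.subset_span ⟨n, rfl⟩)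

theorem isICanonicalBasisUi_dvev : IsICanonicalBasisUi dvev where
  linearIndependent := linearIndependent_dvev
  span_eq_top := span_dvev
  integral_span := span_Aq_dvev
  invariant := ⟨barUi, isIBarAlg_barUi, barUi_dvev⟩
  stable n := ⟨n, fun l hl => ⟨by omega, isICanonicalElement_dvev l ⟨n, by omega⟩⟩⟩

theorem IsICanonicalBasisUi.eq_dvev {b : ℕ → Ui} (h : IsICanonicalBasisUi b) : b = dvev := by
  funext n
  obtain ⟨l₀, hl₀⟩ := h.stable n
  rw [← sub_eq_zero]
  refine eq_zero_of_smul_vPlus l₀ fun l hl => ?_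
  obtain ⟨hn, he⟩ := hl₀ l hl
  rw [sub_smul, he.eq_dvev, sub_self]

end
end ISl2
open ISl2 in
/-- For each `l`, the `ı`-divided powers applied to `v⁺` form the `ı`-canonical basis of `L(2l)`, or
vanish, with unitriangular positive transition matrix to the canonical basis; they also form the
`ı`-canonical basis of `Uⁱ`. The facts that make these notions meaningful are part of the claim. -/
theorem mainTheorem5 :
    (∀ l : ℕ,
      -- the module, its canonical basis and its bar involution
      (IsSimpleModule U (L (2 * l)) ∧ vPlus (2 * l) ≠ 0 ∧ E • vPlus (2 * l) = 0 ∧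
        K • vPlus (2 * l) = q ^ (2 * l) • vPlus (2 * l)) ∧
      (LinearIndependent Kq (canL (2 * l)) ∧
        Submodule.span Kq (Set.range (canL (2 * l))) = ⊤) ∧
      (∃! ψ : L (2 * l) →ₛₗ[bar] L (2 * l), IsIBar (2 * l) ψ) ∧
      (∀ ψ : L (2 * l) →ₛₗ[bar] L (2 * l), IsIBar (2 * l) ψ ↔
        ∀ n : ℕ, ψ (dvev n • vPlus (2 * l)) = dvev n • vPlus (2 * l)) ∧
      -- the `ı`-divided powers give the `ı`-canonical basis of the module
      IsICanonicalBasisL (2 * l) (fun n : Fin (2 * l + 1) => dvev n • vPlus (2 * l)) ∧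
      (∀ (n : Fin (2 * l + 1)) (x : L (2 * l)), IsICanonicalElement (2 * l) n x →
        x = dvev n • vPlus (2 * l)) ∧
      (∀ n : ℕ, 2 * l < n → dvev n • vPlus (2 * l) = 0) ∧
      -- the transition matrix
      (∃ c : Fin (2 * l + 1) → Fin (2 * l + 1) → Kq,
        (∀ n r : Fin (2 * l + 1), r < n → c n r ∈ qInvN) ∧
        ∀ n : Fin (2 * l + 1), dvev n • vPlus (2 * l) =
          canL (2 * l) n + ∑ r ∈ Finset.univ.filter (· < n), c n r • canL (2 * l) r) ∧
      -- the projective system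
      (∃ π : L (2 * (l + 1)) →ₗ[Ui] L (2 * l), π (vPlus (2 * (l + 1))) = vPlus (2 * l))) ∧
    -- the `ı`-divided powers form the `ı`-canonical basis of `Uⁱ`
    (∃! φ : Ui →+* Ui, IsIBarAlg φ) ∧
    IsICanonicalBasisUi dvev ∧
    (∀ b : ℕ → Ui, IsICanonicalBasisUi b → b = dvev) := by
  refine ⟨fun l => ⟨⟨isSimpleModule_L _, vPlus_ne_zero _, E_smul_vPlus _, K_smul_vPlus _⟩,
    ⟨linearIndependent_canL _, span_canL _⟩, existsUnique_isIBar l, isIBar_iff_dvev l,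
    ⟨(isHighestWeight_vPlus l).dvev_isBasis.1, (isHighestWeight_vPlus l).dvev_isBasis.2,
      isICanonicalElement_dvev l⟩, fun n x hx => hx.eq_dvev,
    fun n hn => (isHighestWeight_vPlus l).dvev_smul_eq_zero hn, ?_,
    (isHighestWeight_vPlus (l + 1)).exists_map (Nat.le_succ l) (isHighestWeight_vPlus l)⟩,
    ⟨barUi, isIBarAlg_barUi, fun φ hφ => hφ.eq_barUi⟩, isICanonicalBasisUi_dvev,
    fun b hb => hb.eq_dvev⟩
  obtain ⟨c, hc, hsum⟩ := exists_transition_L l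
  exact ⟨c, fun n r _ => hc n r, hsum⟩
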